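/- Let $I$ be a finite set and let $\mathcal V=(V,\eta,\xi)$ be a polarized arrangement indexed by $I$: $V\subseteq\mathbb R^I$ is a linear subspace, $\eta\in\mathbb R^I/V$, $\xi\in V^*=(\mathbb R^I)^*/V^\perp$, every lift of $\eta$ to $\mathbb R^I$ has at least $|I|-\dim V$ non-zero entries, and every lift of $\xi$ to $(\mathbb R^I)^*$ has at least $\dim V$ non-zero entries. Let $V_\eta=\{x\in\mathbb R^I\mid x+V=\eta\}$, and for $S\subseteq I$ let $H_S=\{x\in V_\eta\mid x_i=0\text{ for all }i\in S\}$. For $\alpha\in\{\pm1\}^I$ let $\Delta_\alpha=\{x\in V_\eta\mid\alpha(i)x_i\ge0\ \forall i\}$ and $\Sigma_\alpha=\{x\in V\mid\alpha(i)x_i\ge0\ \forall i\}$, and let $\mathcal P$ be the set of those $\alpha$ for which $\Delta_\alpha\ne\emptyset$ and $\xi(\Sigma_\alpha)$ is bounded above. Write $\operatorname{Sym}\mathbb R^I=\mathbb R[u_i]_{i\in I}$ and $u_S=\prod_{i\in S}u_i$. For $\Delta\subseteq V_\eta$ put $$\tilde R_\Delta=\operatorname{Sym}\mathbb R^I/\langle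 u_S\mid S\subseteq I,\ H_S\cap\Delta=\emptyset\rangle,\qquad R_\Delta=\tilde R_\Delta\otimes_{\operatorname{Sym}V}\mathbb R,$$ where $\operatorname{Sym}V\to\mathbb R$ kills $V$. Let $\tilde R_{\mathcal H}=\tilde R_{V_\eta}$ (the face ring of the matroid), $R_{\mathcal H}=R_{V_\eta}$, $\tilde R_{\alpha\beta}=\tilde R_{\Delta_\alpha\cap\Delta_\beta}$, $R_{\alpha\beta}=R_{\Delta_\alpha\cap\Delta_\beta}$, and similarly for triple intersections. Let $$\tilde B=\bigoplus_{(\alpha,\beta)\in\mathcal P\times\mathcal P}\tilde R_{\alpha\beta},\qquad B=\bigoplus_{(\alpha,\beta)\in\mathcal P\times\mathcal P}R_{\alpha\beta},$$ with the product $\tilde R_{\alpha\beta}\otimes\tilde R_{\beta\gamma}\to\tilde R_{\alpha\beta\gamma}\to\tilde R_{\alpha\gamma}$ obtained by multiplying the images in $\tilde R_{\alpha\beta\gamma}$ and then multiplying by $u_{S(\alpha\beta\gamma)}$, where $S(\alpha\beta\gamma)=\{i\mid\alpha(i)=\gamma(i)\neq\beta(i)\}$ (all other products of summands being zero), and similarly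 for $B$. Let $\zeta:\operatorname{Sym}\mathbb R^I\to\tilde B$ be the ring homomorphism $p\mapsto\sum_{\alpha\in\mathcal P}[p]\in\bigoplus_\alpha\tilde R_{\alpha\alpha}$, and let $\tilde B\to B$ be the quotient homomorphism $\tilde R_{\alpha\beta}\to R_{\alpha\beta}$ on each summand. Then the image of $\zeta$ is the center $Z(\tilde B)$ of $\tilde B$, and $Z(\tilde B)$ is isomorphic to $\tilde R_{\mathcal H}$ as a quotient of $\operatorname{Sym}\mathbb R^I$. The quotient homomorphism $\tilde B\to B$ maps $Z(\tilde B)$ onto $Z(B)$, and yields an isomorphism $Z(B)\cong R_{\mathcal H}$ of quotients of $\operatorname{Sym}\mathbb R^I$. -/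

import Mathlib

/-- A polarized arrangement `(V, η, ξ)` indexed by a finite set `I`. -/
structure PolarizedArrangement (I : Type*) [Fintype I] where
  /-- the linear subspace `V ⊆ ℝ^I` -/
  V : Submodule ℝ (I → ℝ)
  /-- the vector `η ∈ ℝ^I / V` -/
  η : (I → ℝ) ⧸ V
  /-- the covector `ξ ∈ V^*` -/
  ξ : Module.Dual ℝ V
  /-- (a) every lift of `η` to `ℝ^I` has at least `|I| - dim V` non-zero entries -/
  η_generic : ∀ x : I → ℝ, V.mkQ x = η →
    Fintype.card I ≤ Module.finrank ℝ V + (Finset.univ.filter fun i => x i ≠ 0).card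
  /-- (b) every lift of `ξ` to `(ℝ^I)^*` has at least `dim V` non-zero entries -/
  ξ_generic : ∀ c : I → ℝ, (∀ v : V, ξ v = ∑ i, c i * (v : I → ℝ) i) →
    Module.finrank ℝ V ≤ (Finset.univ.filter fun i => c i ≠ 0).card

namespace PolarizedArrangement

variable {I : Type*} [Fintype I] (𝒱 : PolarizedArrangement I)

/-- The affine space `V_η ⊆ ℝ^I`. -/
def affineSpace : Set (I → ℝ) := {x | 𝒱.V.mkQ x = 𝒱.η}

/-- The flat `H_S = ⋂_{i ∈ S} H_i` with `H_i = {x ∈ V_η | x_i = 0}`; `H_∅ = V_η`. -/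
def flat (S : Finset I) : Set (I → ℝ) := {x | x ∈ 𝒱.affineSpace ∧ ∀ i ∈ S, x i = 0}

/-- The closed chamber `Δ_α ⊆ V_η` of a sign vector `α ∈ {±1}^I`. -/
def chamber (α : I → ℤˣ) : Set (I → ℝ) :=
  {x | x ∈ 𝒱.affineSpace ∧ ∀ i, 0 ≤ ((α i : ℤ) : ℝ) * x i}

/-- The cone `Σ_α ⊆ V` of a sign vector `α`. -/
def cone (α : I → ℤˣ) : Set 𝒱.V :=
  {v | ∀ i, 0 ≤ ((α i : ℤ) : ℝ) * (v : I → ℝ) i}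

/-- Feasible sign vectors: `Δ_α ≠ ∅`. -/
def feasible : Set (I → ℤˣ) := {α | (𝒱.chamber α).Nonempty}

/-- Bounded sign vectors: `ξ(Σ_α)` is bounded above. -/
def bounded : Set (I → ℤˣ) := {α | BddAbove (𝒱.ξ '' 𝒱.cone α)}

/-- The type `𝒫` of bounded feasible sign vectors. -/
def P : Type _ := {α : I → ℤˣ // α ∈ 𝒱.feasible ∩ 𝒱.bounded}

noncomputable instance : Fintype 𝒱.P :=
  haveI : Finite 𝒱.P := inferInstanceAs (Finite {α : I → ℤˣ // α ∈ 𝒱.feasible ∩ 𝒱.bounded})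
  Fintype.ofFinite _

noncomputable instance : DecidableEq 𝒱.P := Classical.decEq _

/-- The chamber of a bounded feasible sign vector. -/
def Δ (α : 𝒱.P) : Set (I → ℝ) := 𝒱.chamber α.1

/-- The ideal `⟨u_S | H_S ∩ Δ = ∅⟩` of `Sym ℝ^I = ℝ[u_i]_{i ∈ I}`. -/
noncomputable def faceIdeal (D : Set (I → ℝ)) : Ideal (MvPolynomial I ℝ) :=
  Ideal.span {p | ∃ S : Finset I, 𝒱.flat S ∩ D = ∅ ∧ p = ∏ i ∈ S, MvPolynomial.X i}

/-- The ideal of `Sym ℝ^I` generated by `V ⊆ ℝ^I`, where `v ∈ ℝ^I` is the linear form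
`∑ v_i u_i`. For a `Sym ℝ^I`-algebra `R`, the tensor product `R ⊗_{Sym V} ℝ` is the quotient
of `R` by the extension of this ideal. -/
noncomputable def linearIdeal : Ideal (MvPolynomial I ℝ) :=
  Ideal.span {p | ∃ v ∈ 𝒱.V, p = ∑ i, MvPolynomial.C (v i) * MvPolynomial.X i}

/-- The face ring of `Δ` modulo the ideal generated by `K`. With `K = ⊥` this is `R̃_Δ`, with
`K = 𝒱.linearIdeal` it is `R_Δ = R̃_Δ ⊗_{Sym V} ℝ`. -/
abbrev FaceRing (K : Ideal (MvPolynomial I ℝ)) (D : Set (I → ℝ)) : Type _ :=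
  MvPolynomial I ℝ ⧸ (𝒱.faceIdeal D ⊔ K)

/-- The face ring `R̃_ℋ` of the matroid. -/
abbrev RtildeH : Type _ := 𝒱.FaceRing ⊥ 𝒱.affineSpace

/-- The ring `R_ℋ = R̃_ℋ ⊗_{Sym V} ℝ`. -/
abbrev RH : Type _ := 𝒱.FaceRing 𝒱.linearIdeal 𝒱.affineSpace

theorem faceIdeal_anti {D E : Set (I → ℝ)} (h : D ⊆ E) : 𝒱.faceIdeal E ≤ 𝒱.faceIdeal D := by
  refine Ideal.span_mono ?_
  rintro p ⟨S, hS, rfl⟩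
  exact ⟨S, Set.subset_empty_iff.1 (hS ▸ Set.inter_subset_inter_right _ h), rfl⟩

/-- The natural quotient map between face rings for `D ⊆ E`. -/
noncomputable def restrict (K : Ideal (MvPolynomial I ℝ)) {D E : Set (I → ℝ)} (h : D ⊆ E) :
    𝒱.FaceRing K E →ₐ[ℝ] 𝒱.FaceRing K D :=
  Ideal.Quotient.factorₐ ℝ (sup_le_sup_right (𝒱.faceIdeal_anti h) K)

/-- `S(αβγ) = {i | α(i) = γ(i) ≠ β(i)}`. -/
def crossing (α β γ : 𝒱.P) : Finset I :=
  Finset.univ.filter fun i => α.1 i = γ.1 i ∧ γ.1 i ≠ β.1 i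

/-- The monomial `u_{S(αβγ)}`. -/
noncomputable def crossingMonomial (α β γ : 𝒱.P) : MvPolynomial I ℝ :=
  ∏ i ∈ 𝒱.crossing α β γ, MvPolynomial.X i

theorem flat_crossing_subset (α β γ : 𝒱.P) :
    𝒱.flat (𝒱.crossing α β γ) ∩ (𝒱.Δ α ∩ 𝒱.Δ γ) ⊆ 𝒱.Δ α ∩ 𝒱.Δ β ∩ 𝒱.Δ γ := by
  rintro x ⟨hS, hα, hγ⟩
  refine ⟨⟨hα, hα.1, fun i => ?_⟩, hγ⟩
  by_cases h : γ.1 i = β.1 i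
  · rw [← h]; exact hγ.2 i
  · by_cases h' : α.1 i = β.1 i
    · rw [← h']; exact hα.2 i
    · have hi : i ∈ 𝒱.crossing α β γ := by
        simp only [crossing, Finset.mem_filter, Finset.mem_univ, true_and]
        refine ⟨?_, h⟩
        rcases Int.units_eq_one_or (α.1 i) with a | a <;>
        rcases Int.units_eq_one_or (β.1 i) with b | b <;>
        rcases Int.units_eq_one_or (γ.1 i) with c | c <;> simp_all
      rw [hS.2 i hi, mul_zero]

theorem crossingMonomial_mul_mem (K : Ideal (MvPolynomial I ℝ)) (α β γ : 𝒱.P)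
    {p : MvPolynomial I ℝ} (hp : p ∈ 𝒱.faceIdeal (𝒱.Δ α ∩ 𝒱.Δ β ∩ 𝒱.Δ γ) ⊔ K) :
    𝒱.crossingMonomial α β γ * p ∈ 𝒱.faceIdeal (𝒱.Δ α ∩ 𝒱.Δ γ) ⊔ K := by
  classical
  suffices h : 𝒱.faceIdeal (𝒱.Δ α ∩ 𝒱.Δ β ∩ 𝒱.Δ γ) ≤
      Submodule.comap (LinearMap.mulLeft (MvPolynomial I ℝ) (𝒱.crossingMonomial α β γ))
        (𝒱.faceIdeal (𝒱.Δ α ∩ 𝒱.Δ γ)) by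
    obtain ⟨a, ha, b, hb, rfl⟩ := Submodule.mem_sup.1 hp
    rw [mul_add]
    exact Submodule.add_mem_sup (h ha) (K.mul_mem_left _ hb)
  refine Ideal.span_le.2 ?_
  rintro p ⟨T, hT, rfl⟩
  change 𝒱.crossingMonomial α β γ * _ ∈ 𝒱.faceIdeal (𝒱.Δ α ∩ 𝒱.Δ γ)
  rw [crossingMonomial, ← Finset.prod_union_inter]
  refine Ideal.mul_mem_right _ _ (Ideal.subset_span ⟨_, ?_, rfl⟩)
  refine Set.subset_empty_iff.1 (hT ▸ ?_)
  rintro x ⟨hx, hD⟩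
  exact ⟨⟨hx.1, fun i hi => hx.2 i (Finset.mem_union_right _ hi)⟩,
    𝒱.flat_crossing_subset α β γ
      ⟨⟨hx.1, fun i hi => hx.2 i (Finset.mem_union_left _ hi)⟩, hD⟩⟩

/-- Multiplication by `u_{S(αβγ)}` as a map `R_{αβγ} → R_{αγ}`. -/
noncomputable def mulCrossing (K : Ideal (MvPolynomial I ℝ)) (α β γ : 𝒱.P) :
    𝒱.FaceRing K (𝒱.Δ α ∩ 𝒱.Δ β ∩ 𝒱.Δ γ) →ₗ[MvPolynomial I ℝ]
      𝒱.FaceRing K (𝒱.Δ α ∩ 𝒱.Δ γ) :=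
  Submodule.mapQ _ _ (LinearMap.mulLeft (MvPolynomial I ℝ) (𝒱.crossingMonomial α β γ))
    fun _ hp => 𝒱.crossingMonomial_mul_mem K α β γ hp

/-- The product `R_{αβ} × R_{βγ} → R_{αβγ} × R_{αβγ} → R_{αβγ} → R_{αγ}`. -/
noncomputable def star (K : Ideal (MvPolynomial I ℝ)) (α β γ : 𝒱.P)
    (x : 𝒱.FaceRing K (𝒱.Δ α ∩ 𝒱.Δ β)) (y : 𝒱.FaceRing K (𝒱.Δ β ∩ 𝒱.Δ γ)) :
    𝒱.FaceRing K (𝒱.Δ α ∩ 𝒱.Δ γ) :=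
  𝒱.mulCrossing K α β γ
    (𝒱.restrict K (Set.inter_subset_left : 𝒱.Δ α ∩ 𝒱.Δ β ∩ 𝒱.Δ γ ⊆ 𝒱.Δ α ∩ 𝒱.Δ β) x *
      𝒱.restrict K (Set.inter_subset_inter_left _ Set.inter_subset_right :
        𝒱.Δ α ∩ 𝒱.Δ β ∩ 𝒱.Δ γ ⊆ 𝒱.Δ β ∩ 𝒱.Δ γ) y)

theorem star_mk (K : Ideal (MvPolynomial I ℝ)) (α β γ : 𝒱.P) (p q : MvPolynomial I ℝ) :
    𝒱.star K α β γ (Ideal.Quotient.mk _ p) (Ideal.Quotient.mk _ q) =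
      Ideal.Quotient.mk _ (𝒱.crossingMonomial α β γ * (p * q)) := rfl

theorem star_add (K : Ideal (MvPolynomial I ℝ)) (α β γ : 𝒱.P)
    (x : 𝒱.FaceRing K (𝒱.Δ α ∩ 𝒱.Δ β)) (y z : 𝒱.FaceRing K (𝒱.Δ β ∩ 𝒱.Δ γ)) :
    𝒱.star K α β γ x (y + z) = 𝒱.star K α β γ x y + 𝒱.star K α β γ x z := by
  simp [star, mul_add]

theorem add_star (K : Ideal (MvPolynomial I ℝ)) (α β γ : 𝒱.P)
    (x y : 𝒱.FaceRing K (𝒱.Δ α ∩ 𝒱.Δ β)) (z : 𝒱.FaceRing K (𝒱.Δ β ∩ 𝒱.Δ γ)) :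
    𝒱.star K α β γ (x + y) z = 𝒱.star K α β γ x z + 𝒱.star K α β γ y z := by
  simp [star, add_mul]

theorem star_zero (K : Ideal (MvPolynomial I ℝ)) (α β γ : 𝒱.P)
    (x : 𝒱.FaceRing K (𝒱.Δ α ∩ 𝒱.Δ β)) : 𝒱.star K α β γ x 0 = 0 := by
  simp [star]

theorem zero_star (K : Ideal (MvPolynomial I ℝ)) (α β γ : 𝒱.P)
    (x : 𝒱.FaceRing K (𝒱.Δ β ∩ 𝒱.Δ γ)) : 𝒱.star K α β γ 0 x = 0 := by
  simp [star]

theorem star_sum (K : Ideal (MvPolynomial I ℝ)) (α β γ : 𝒱.P) {ι : Type*} (s : Finset ι)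
    (x : 𝒱.FaceRing K (𝒱.Δ α ∩ 𝒱.Δ β)) (y : ι → 𝒱.FaceRing K (𝒱.Δ β ∩ 𝒱.Δ γ)) :
    𝒱.star K α β γ x (∑ j ∈ s, y j) = ∑ j ∈ s, 𝒱.star K α β γ x (y j) := by
  simp [star, Finset.mul_sum]

theorem sum_star (K : Ideal (MvPolynomial I ℝ)) (α β γ : 𝒱.P) {ι : Type*} (s : Finset ι)
    (x : ι → 𝒱.FaceRing K (𝒱.Δ α ∩ 𝒱.Δ β)) (y : 𝒱.FaceRing K (𝒱.Δ β ∩ 𝒱.Δ γ)) :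
    𝒱.star K α β γ (∑ j ∈ s, x j) y = ∑ j ∈ s, 𝒱.star K α β γ (x j) y := by
  simp [star, Finset.sum_mul]

theorem crossingMonomial_left (α γ : 𝒱.P) : 𝒱.crossingMonomial α α γ = 1 := by
  rw [crossingMonomial, crossing, Finset.filter_false_of_mem, Finset.prod_empty]
  intro i _ h
  exact h.2 h.1.symm

theorem crossingMonomial_right (α γ : 𝒱.P) : 𝒱.crossingMonomial α γ γ = 1 := by
  rw [crossingMonomial, crossing, Finset.filter_false_of_mem, Finset.prod_empty]
  intro i _ h
  exact h.2 rfl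

theorem crossingMonomial_cocycle (α β γ δ : 𝒱.P) :
    𝒱.crossingMonomial α γ δ * 𝒱.crossingMonomial α β γ =
      𝒱.crossingMonomial α β δ * 𝒱.crossingMonomial β γ δ := by
  simp only [crossingMonomial, crossing, Finset.prod_filter, ← Finset.prod_mul_distrib]
  refine Finset.prod_congr rfl fun i _ => ?_
  rcases Int.units_eq_one_or (α.1 i) with a | a <;>
  rcases Int.units_eq_one_or (β.1 i) with b | b <;>
  rcases Int.units_eq_one_or (γ.1 i) with c | c <;>
  rcases Int.units_eq_one_or (δ.1 i) with d | d <;>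
  simp [a, b, c, d]

theorem star_assoc (K : Ideal (MvPolynomial I ℝ)) (α β γ δ : 𝒱.P)
    (x : 𝒱.FaceRing K (𝒱.Δ α ∩ 𝒱.Δ β)) (y : 𝒱.FaceRing K (𝒱.Δ β ∩ 𝒱.Δ γ))
    (z : 𝒱.FaceRing K (𝒱.Δ γ ∩ 𝒱.Δ δ)) :
    𝒱.star K α γ δ (𝒱.star K α β γ x y) z = 𝒱.star K α β δ x (𝒱.star K β γ δ y z) := by
  obtain ⟨p, rfl⟩ := Ideal.Quotient.mk_surjective x
  obtain ⟨q, rfl⟩ := Ideal.Quotient.mk_surjective y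
  obtain ⟨r, rfl⟩ := Ideal.Quotient.mk_surjective z
  simp only [star_mk]
  congr 1
  linear_combination (p * q * r) * 𝒱.crossingMonomial_cocycle α β γ δ

theorem mk_star (K : Ideal (MvPolynomial I ℝ)) (α γ : 𝒱.P) (p : MvPolynomial I ℝ)
    (y : 𝒱.FaceRing K (𝒱.Δ α ∩ 𝒱.Δ γ)) :
    𝒱.star K α α γ (Ideal.Quotient.mk _ p) y = Ideal.Quotient.mk _ p * y := by
  obtain ⟨q, rfl⟩ := Ideal.Quotient.mk_surjective y
  rw [star_mk, crossingMonomial_left, one_mul, map_mul]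

theorem star_mk_right (K : Ideal (MvPolynomial I ℝ)) (α γ : 𝒱.P) (p : MvPolynomial I ℝ)
    (x : 𝒱.FaceRing K (𝒱.Δ α ∩ 𝒱.Δ γ)) :
    𝒱.star K α γ γ x (Ideal.Quotient.mk _ p) = x * Ideal.Quotient.mk _ p := by
  obtain ⟨q, rfl⟩ := Ideal.Quotient.mk_surjective x
  rw [star_mk, crossingMonomial_right, one_mul, map_mul]

/-- The direct sum `⨁_{(α,β) ∈ 𝒫 × 𝒫} R_{αβ}`, with `R_{αβ}` the face ring of `Δ_α ∩ Δ_β`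
modulo `K`; an element is the family of its components. -/
def ConvAlg (K : Ideal (MvPolynomial I ℝ)) : Type _ :=
  ∀ α β : 𝒱.P, 𝒱.FaceRing K (𝒱.Δ α ∩ 𝒱.Δ β)

namespace ConvAlg

variable {𝒱} {K : Ideal (MvPolynomial I ℝ)}

noncomputable instance : AddCommGroup (𝒱.ConvAlg K) :=
  inferInstanceAs (AddCommGroup (∀ α β : 𝒱.P, 𝒱.FaceRing K (𝒱.Δ α ∩ 𝒱.Δ β)))

noncomputable instance : Module ℝ (𝒱.ConvAlg K) :=
  inferInstanceAs (Module ℝ (∀ α β : 𝒱.P, 𝒱.FaceRing K (𝒱.Δ α ∩ 𝒱.Δ β)))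

noncomputable instance : Mul (𝒱.ConvAlg K) :=
  ⟨fun x y α γ => ∑ β, 𝒱.star K α β γ (x α β) (y β γ)⟩

noncomputable instance : One (𝒱.ConvAlg K) := ⟨fun α β => if α = β then 1 else 0⟩

@[ext] theorem ext {x y : 𝒱.ConvAlg K} (h : ∀ α β, x α β = y α β) : x = y :=
  funext fun α => funext fun β => h α β

theorem add_apply (x y : 𝒱.ConvAlg K) (α β : 𝒱.P) : (x + y) α β = x α β + y α β := rfl

theorem zero_apply (α β : 𝒱.P) : (0 : 𝒱.ConvAlg K) α β = 0 := rfl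

theorem smul_apply (r : ℝ) (x : 𝒱.ConvAlg K) (α β : 𝒱.P) : (r • x) α β = r • x α β := rfl

theorem mul_apply (x y : 𝒱.ConvAlg K) (α γ : 𝒱.P) :
    (x * y) α γ = ∑ β, 𝒱.star K α β γ (x α β) (y β γ) := rfl

theorem one_apply (α β : 𝒱.P) : (1 : 𝒱.ConvAlg K) α β = if α = β then 1 else 0 := rfl

/-- The element of the direct sum with all diagonal components equal to the class of `p`, and
all other components equal to zero. -/
noncomputable def diag (K : Ideal (MvPolynomial I ℝ)) (p : MvPolynomial I ℝ) : 𝒱.ConvAlg K :=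
  fun α β => if α = β then Ideal.Quotient.mk _ p else 0

theorem diag_apply (p : MvPolynomial I ℝ) (α β : 𝒱.P) :
    diag (𝒱 := 𝒱) K p α β = if α = β then Ideal.Quotient.mk _ p else 0 := rfl

theorem diag_mul_apply (p : MvPolynomial I ℝ) (x : 𝒱.ConvAlg K) (α γ : 𝒱.P) :
    (diag K p * x : 𝒱.ConvAlg K) α γ = Ideal.Quotient.mk _ p * x α γ := by
  rw [mul_apply, Finset.sum_eq_single α, diag_apply, if_pos rfl, mk_star]
  · intro β _ h
    rw [diag_apply, if_neg (Ne.symm h), zero_star]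
  · simp

theorem mul_diag_apply (p : MvPolynomial I ℝ) (x : 𝒱.ConvAlg K) (α γ : 𝒱.P) :
    (x * diag K p : 𝒱.ConvAlg K) α γ = x α γ * Ideal.Quotient.mk _ p := by
  rw [mul_apply, Finset.sum_eq_single γ, diag_apply, if_pos rfl, star_mk_right]
  · intro β _ h
    rw [diag_apply, if_neg h, star_zero]
  · simp

theorem one_eq_diag : (1 : 𝒱.ConvAlg K) = diag K 1 := rfl

noncomputable instance : Ring (𝒱.ConvAlg K) where
  __ := (inferInstance : AddCommGroup (𝒱.ConvAlg K))
  __ := (inferInstance : Mul (𝒱.ConvAlg K))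
  __ := (inferInstance : One (𝒱.ConvAlg K))
  left_distrib x y z := by
    ext α γ
    simp only [mul_apply, add_apply, star_add, Finset.sum_add_distrib]
  right_distrib x y z := by
    ext α γ
    simp only [mul_apply, add_apply, add_star, Finset.sum_add_distrib]
  zero_mul x := by
    ext α γ
    simp only [mul_apply, zero_apply, zero_star, Finset.sum_const_zero]
  mul_zero x := by
    ext α γ
    simp only [mul_apply, zero_apply, star_zero, Finset.sum_const_zero]
  mul_assoc x y z := by
    ext α δ
    simp only [mul_apply, star_sum, sum_star, star_assoc]
    exact Finset.sum_comm
  one_mul x := by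
    ext α γ
    rw [one_eq_diag, diag_mul_apply, map_one, one_mul]
  mul_one x := by
    ext α γ
    rw [one_eq_diag, mul_diag_apply, map_one, mul_one]

theorem star_smul (r : ℝ) (α β γ : 𝒱.P)
    (x : 𝒱.FaceRing K (𝒱.Δ α ∩ 𝒱.Δ β)) (y : 𝒱.FaceRing K (𝒱.Δ β ∩ 𝒱.Δ γ)) :
    𝒱.star K α β γ x (r • y) = r • 𝒱.star K α β γ x y := by
  simp only [star, map_smul, mul_smul_comm]
  exact (𝒱.mulCrossing K α β γ).map_smul_of_tower r _

theorem smul_star (r : ℝ) (α β γ : 𝒱.P)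
    (x : 𝒱.FaceRing K (𝒱.Δ α ∩ 𝒱.Δ β)) (y : 𝒱.FaceRing K (𝒱.Δ β ∩ 𝒱.Δ γ)) :
    𝒱.star K α β γ (r • x) y = r • 𝒱.star K α β γ x y := by
  simp only [star, map_smul, smul_mul_assoc]
  exact (𝒱.mulCrossing K α β γ).map_smul_of_tower r _

noncomputable instance : Algebra ℝ (𝒱.ConvAlg K) :=
  Algebra.ofModule
    (fun r x y => by
      ext α γ
      simp only [mul_apply, smul_apply, smul_star, Finset.smul_sum])
    (fun r x y => by
      ext α γ
      simp only [mul_apply, smul_apply, star_smul, Finset.smul_sum])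

end ConvAlg

/-- The algebra `B̃ = ⨁ R̃_{αβ}`. -/
abbrev Btilde : Type _ := 𝒱.ConvAlg ⊥

/-- The algebra `B = ⨁ R_{αβ}`. -/
abbrev B : Type _ := 𝒱.ConvAlg 𝒱.linearIdeal

/-- The homomorphism `ζ : Sym ℝ^I → ⨁_α R̃_{αα} → B̃`. -/
noncomputable def ζ : MvPolynomial I ℝ →ₐ[ℝ] 𝒱.Btilde where
  toFun p := ConvAlg.diag ⊥ p
  map_one' := rfl
  map_zero' := by
    ext α β
    simp [ConvAlg.diag_apply, ConvAlg.zero_apply]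
  map_mul' p q := by
    ext α γ
    rw [ConvAlg.diag_mul_apply, ConvAlg.diag_apply, ConvAlg.diag_apply]
    split_ifs <;> simp
  map_add' p q := by
    ext α γ
    rw [ConvAlg.add_apply]
    simp only [ConvAlg.diag_apply]
    split_ifs <;> simp
  commutes' r := by
    ext α γ
    rw [Algebra.algebraMap_eq_smul_one, Algebra.algebraMap_eq_smul_one, ConvAlg.smul_apply,
      ConvAlg.one_apply, ConvAlg.diag_apply]
    split_ifs with h
    · rfl
    · simp

/-- The map `R̃_{αβ} → R_{αβ}` on all components. -/
noncomputable def toB (x : 𝒱.Btilde) : 𝒱.B :=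
  fun α β => Ideal.Quotient.factorₐ ℝ (sup_le_sup_left bot_le _) (x α β)

theorem toB_apply (x : 𝒱.Btilde) (α β : 𝒱.P) :
    𝒱.toB x α β = Ideal.Quotient.factorₐ ℝ (sup_le_sup_left bot_le _) (x α β) := rfl

theorem factor_star (α β γ : 𝒱.P)
    (x : 𝒱.FaceRing ⊥ (𝒱.Δ α ∩ 𝒱.Δ β)) (y : 𝒱.FaceRing ⊥ (𝒱.Δ β ∩ 𝒱.Δ γ)) :
    Ideal.Quotient.factorₐ ℝ (sup_le_sup_left bot_le _) (𝒱.star ⊥ α β γ x y) =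
      𝒱.star 𝒱.linearIdeal α β γ
        (Ideal.Quotient.factorₐ ℝ (sup_le_sup_left bot_le _) x)
        (Ideal.Quotient.factorₐ ℝ (sup_le_sup_left bot_le _) y) := by
  obtain ⟨p, rfl⟩ := Ideal.Quotient.mk_surjective x
  obtain ⟨q, rfl⟩ := Ideal.Quotient.mk_surjective y
  rw [star_mk, Ideal.Quotient.factorₐ_apply_mk, Ideal.Quotient.factorₐ_apply_mk,
    Ideal.Quotient.factorₐ_apply_mk, star_mk]

/-- The quotient homomorphism `B̃ → B`, given on components by `R̃_{αβ} → R_{αβ}`. -/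
noncomputable def quotientHom : 𝒱.Btilde →ₐ[ℝ] 𝒱.B where
  toFun := 𝒱.toB
  map_one' := by
    ext α β
    rw [toB_apply, ConvAlg.one_apply, ConvAlg.one_apply]
    split_ifs
    · exact map_one _
    · exact map_zero _
  map_zero' := by
    ext α β
    rw [toB_apply, ConvAlg.zero_apply, ConvAlg.zero_apply]
    exact map_zero _
  map_mul' x y := by
    ext α γ
    rw [toB_apply, ConvAlg.mul_apply, ConvAlg.mul_apply, map_sum]
    exact Finset.sum_congr rfl fun β _ => 𝒱.factor_star α β γ (x α β) (y β γ)
  map_add' x y := by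
    ext α β
    rw [toB_apply, ConvAlg.add_apply, ConvAlg.add_apply]
    exact map_add _ _ _
  commutes' r := by
    ext α β
    rw [Algebra.algebraMap_eq_smul_one, Algebra.algebraMap_eq_smul_one, toB_apply,
      ConvAlg.smul_apply, ConvAlg.smul_apply, ConvAlg.one_apply, ConvAlg.one_apply, map_smul]
    split_ifs
    · rw [map_one]
    · rw [map_zero]

end PolarizedArrangement

/-!
The idempotents `1 ∈ R_{αα}` force a central element of `⨁ R_{αβ}` to be diagonal, and
commutation with `1 ∈ R_{αβ}` forces its components to agree in `R_{αβ}`. So the center is the ring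
of families `(p_α)` with `α ∈ 𝒫`, `p_α ∈ R_{Δ_α}`, that agree on intersections of chambers, and the
theorem says that the face ring satisfies the sheaf condition (`Glues`) for the covering of the
arrangement by its bounded feasible chambers. This has to be shown for `R̃` and for its quotient `R`
by a basis `θ` of `V`; both are treated at once, modulo an initial segment of `θ`.

The sheaf condition is proved for every region cut out of `V_η` by sign conditions on coordinates
(`glues_region`), by descending induction on the number of conditions.

* If a coordinate `i` is unconstrained, the region is the union of its two halves along `H_i`. By
  convexity, a flat meeting both halves meets their intersection, so the face ideals satisfy
  `I = I₊ ⊓ I₋` and `I₀ = I₊ ⊔ I₋`. The resulting Mayer–Vietoris sequence stays exact modulo `θ`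
  because `θ` is a regular sequence on the face ring of every region (`regularMod_region`).
* If all coordinates are constrained, the region is a face. If it lies in a chamber from `𝒫` there
  is nothing to show. Otherwise it recedes in a direction `y` with `ξ(y) > 0`
  (`exists_direction`), a bounded chamber meets it only inside facets transverse to `y`, and its
  face ring glues from those facets (`Glues.of_direction`).

Regularity and gluing along facets both come from a shelling of the complex of faces of a chamber:
the faces are ordered by their lowest vertex with respect to a generic positive functional
(`shellable_chamber`). Genericity of `η` makes the vanishing coordinates at each vertex a basis, so
each shelling step contributes a copy of `Sym V`. As the functional is positive on `y`, at each
vertex some upward edge leaves a facet transverse to `y`, which is what the gluing of a shelling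
step needs (`Shellable.exists_forall_sub_mem_star`).
-/

/-! ### Sequences that are regular modulo an ideal -/

section RegularMod

variable {A : Type*} [CommRing A]

theorem Ideal.mem_sup_of_le_left {I J K : Ideal A} (h : I ≤ J) {x : A} (hx : x ∈ I ⊔ K) :
    x ∈ J ⊔ K :=
  sup_le_sup_right h K hx

/-- The ideal generated by the first `k` members of the sequence `θ`. -/
def initialIdeal (θ : ℕ → A) (k : ℕ) : Ideal A :=
  Ideal.span (θ '' Set.Iio k)

theorem initialIdeal_zero (θ : ℕ → A) : initialIdeal θ 0 = ⊥ := by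
  simp [initialIdeal]

theorem initialIdeal_succ (θ : ℕ → A) (k : ℕ) :
    initialIdeal θ (k + 1) = initialIdeal θ k ⊔ Ideal.span {θ k} := by
  rw [initialIdeal, initialIdeal, ← Ideal.span_union]
  congr 1
  ext x
  simp only [Set.mem_image, Set.mem_Iio, Set.mem_union, Set.mem_singleton_iff]
  constructor
  · rintro ⟨j, hj, rfl⟩
    rcases Nat.lt_succ_iff_lt_or_eq.1 hj with h | rfl
    · exact Or.inl ⟨j, h, rfl⟩
    · exact Or.inr rfl
  · rintro (⟨j, hj, rfl⟩ | rfl)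
    · exact ⟨j, hj.trans (Nat.lt_succ_self k), rfl⟩
    · exact ⟨k, Nat.lt_succ_self k, rfl⟩

theorem mem_sup_initialIdeal_succ {θ : ℕ → A} {k : ℕ} {J : Ideal A} {x : A} :
    x ∈ J ⊔ initialIdeal θ (k + 1) ↔ ∃ r, x - θ k * r ∈ J ⊔ initialIdeal θ k := by
  rw [initialIdeal_succ, ← sup_assoc, sup_comm, Ideal.mem_span_singleton_sup]
  constructor
  · rintro ⟨r, b, hb, rfl⟩
    exact ⟨r, by convert hb using 1; ring⟩
  · rintro ⟨r, hr⟩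
    exact ⟨r, _, hr, by ring⟩

/-- The first `d` members of `θ` form a weakly regular sequence on `A ⧸ J`, expressed through
membership in ideals of `A`. -/
def RegularMod (θ : ℕ → A) (d : ℕ) (J : Ideal A) : Prop :=
  ∀ k < d, ∀ x, θ k * x ∈ J ⊔ initialIdeal θ k → x ∈ J ⊔ initialIdeal θ k

variable {θ : ℕ → A} {d : ℕ}

theorem regularMod_top : RegularMod θ d ⊤ := fun k _ x _ => by simp

/-- If `θ` is regular on the last term of
`0 → A ⧸ (I₁ ⊓ I₂) → A ⧸ I₁ × A ⧸ I₂ → A ⧸ (I₁ ⊔ I₂) → 0`, the sequence stays exact modulo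
`θ`. -/
theorem RegularMod.inf_sup_initialIdeal_le {I₁ I₂ : Ideal A}
    (h : RegularMod θ d (I₁ ⊔ I₂)) {k : ℕ} (hk : k ≤ d) :
    (I₁ ⊔ initialIdeal θ k) ⊓ (I₂ ⊔ initialIdeal θ k) ≤ (I₁ ⊓ I₂) ⊔ initialIdeal θ k := by
  induction k with
  | zero => simp [initialIdeal_zero]
  | succ k ih =>
    intro x hx
    obtain ⟨h₁, h₂⟩ := Submodule.mem_inf.1 hx
    obtain ⟨r, hr⟩ := mem_sup_initialIdeal_succ.1 h₁
    obtain ⟨s, hs⟩ := mem_sup_initialIdeal_succ.1 h₂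
    have hle₁ : I₁ ⊔ initialIdeal θ k ≤ I₁ ⊔ I₂ ⊔ initialIdeal θ k :=
      sup_le_sup_right le_sup_left _
    have hle₂ : I₂ ⊔ initialIdeal θ k ≤ I₁ ⊔ I₂ ⊔ initialIdeal θ k :=
      sup_le_sup_right le_sup_right _
    have hrs : r - s ∈ I₁ ⊔ I₂ ⊔ initialIdeal θ k := by
      refine h k hk _ ?_
      convert sub_mem (hle₂ hs) (hle₁ hr) using 1
      ring
    rw [sup_sup_distrib_right] at hrs
    obtain ⟨a, ha, b, hb, hab⟩ := Submodule.mem_sup.1 hrs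
    -- the common correction `t = r - a = s + b` brings both memberships down to level `k`
    refine mem_sup_initialIdeal_succ.2
      ⟨r - a, ih (Nat.le_of_succ_le hk) (Submodule.mem_inf.2 ⟨?_, ?_⟩)⟩
    · convert add_mem hr (Ideal.mul_mem_left _ (θ k) ha) using 1
      ring
    · have hra : r - a = s + b := by linear_combination -hab
      rw [hra]
      convert sub_mem hs (Ideal.mul_mem_left _ (θ k) hb) using 1
      ring

theorem RegularMod.inf {I₁ I₂ : Ideal A} (h₁ : RegularMod θ d I₁) (h₂ : RegularMod θ d I₂)
    (h : RegularMod θ d (I₁ ⊔ I₂)) : RegularMod θ d (I₁ ⊓ I₂) := by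
  intro k hk x hx
  exact h.inf_sup_initialIdeal_le hk.le (Submodule.mem_inf.2
    ⟨h₁ k hk x (Ideal.mem_sup_of_le_left inf_le_left hx),
      h₂ k hk x (Ideal.mem_sup_of_le_left inf_le_right hx)⟩)

/-- If `J' = J + (u)` and `P = (J : u)`, then `0 → A ⧸ P → A ⧸ J → A ⧸ J' → 0` is exact; it
stays exact modulo a sequence that is regular on `A ⧸ J'`. -/
theorem RegularMod.mem_of_mul_mem {J J' P : Ideal A} {u : A} (hJ' : J' = J ⊔ Ideal.span {u})
    (hP : ∀ x, u * x ∈ J → x ∈ P) (h : RegularMod θ d J') {k : ℕ} (hk : k ≤ d) {x : A}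
    (hx : u * x ∈ J ⊔ initialIdeal θ k) : x ∈ P ⊔ initialIdeal θ k := by
  have hu : u ∈ J' := hJ' ▸ Ideal.mem_sup_right (Ideal.mem_span_singleton_self u)
  have hJJ' : J ≤ J' := hJ' ▸ le_sup_left
  induction k generalizing x with
  | zero =>
    rw [initialIdeal_zero, sup_bot_eq] at hx ⊢
    exact hP x hx
  | succ k ih =>
    obtain ⟨r, hr⟩ := mem_sup_initialIdeal_succ.1 hx
    have hr' : r ∈ J' ⊔ initialIdeal θ k := by
      refine h k hk _ ?_
      have hux : u * x ∈ J' ⊔ initialIdeal θ k := Ideal.mem_sup_left (Ideal.mul_mem_right x _ hu)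
      convert sub_mem hux (Ideal.mem_sup_of_le_left hJJ' hr) using 1
      ring
    rw [hJ', sup_assoc, sup_comm, sup_assoc, Ideal.mem_span_singleton_sup] at hr'
    obtain ⟨s, t, ht, rfl⟩ := hr'
    rw [sup_comm] at ht
    refine mem_sup_initialIdeal_succ.2 ⟨s, ih (Nat.le_of_succ_le hk) ?_⟩
    convert add_mem hr (Ideal.mul_mem_left _ (θ k) ht) using 1
    ring

/-- If `J' = J + (u)` and `P = (J : u)`, a sequence that is regular on `A ⧸ J'` and `A ⧸ P` is
regular on the extension `A ⧸ J`. -/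
theorem RegularMod.of_colon {J J' P : Ideal A} {u : A} (hJ' : J' = J ⊔ Ideal.span {u})
    (hP : ∀ x, u * x ∈ J ↔ x ∈ P) (h : RegularMod θ d J') (h' : RegularMod θ d P) :
    RegularMod θ d J := by
  intro k hk x hx
  have hx' : x ∈ J' ⊔ initialIdeal θ k :=
    h k hk x (Ideal.mem_sup_of_le_left (hJ' ▸ le_sup_left) hx)
  rw [hJ', sup_assoc, sup_comm, sup_assoc, Ideal.mem_span_singleton_sup] at hx'
  obtain ⟨s, t, ht, rfl⟩ := hx'
  rw [sup_comm] at ht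
  refine add_mem ?_ ht
  have hs : s ∈ P ⊔ initialIdeal θ k := by
    refine h' k hk s (h.mem_of_mul_mem hJ' (fun x => (hP x).1) hk.le ?_)
    convert sub_mem hx (Ideal.mul_mem_left _ (θ k) ht) using 1
    ring
  obtain ⟨a, ha, b, hb, rfl⟩ := Submodule.mem_sup.1 hs
  rw [add_mul]
  refine add_mem (Ideal.mem_sup_left ?_) (Ideal.mem_sup_right (Ideal.mul_mem_right _ _ hb))
  rw [mul_comm]
  exact (hP a).2 ha

end RegularMod

/-! ### Face ideals of simplicial complexes -/

section MonomialIdeal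

open MvPolynomial

variable {I : Type*}

/-- The ideal generated by the squarefree monomials `u_S` with `S` not in the simplicial
complex `m`. A complex is given by its membership predicate; closure under subsets is imposed
separately. -/
noncomputable def monomialIdeal (m : Finset I → Prop) : Ideal (MvPolynomial I ℝ) :=
  Ideal.span {p | ∃ S : Finset I, ¬ m S ∧ p = ∏ i ∈ S, X i}

/-- A predicate on finite sets is a simplicial complex when it passes to subsets. The empty set
need not be a face. -/
def IsComplex (m : Finset I → Prop) : Prop := ∀ ⦃S T⦄, S ⊆ T → m T → m S

theorem prod_X_mem_monomialIdeal {m : Finset I → Prop} {S : Finset I} (h : ¬ m S) :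
    ∏ i ∈ S, X i ∈ monomialIdeal m :=
  Ideal.subset_span ⟨S, h, rfl⟩

theorem monomialIdeal_anti {m m' : Finset I → Prop} (h : ∀ S, m S → m' S) :
    monomialIdeal m' ≤ monomialIdeal m := by
  refine Ideal.span_mono ?_
  rintro p ⟨S, hS, rfl⟩
  exact ⟨S, fun h' => hS (h S h'), rfl⟩

theorem prod_X_eq_monomial (S : Finset I) :
    (∏ i ∈ S, X i : MvPolynomial I ℝ) = monomial (∑ i ∈ S, Finsupp.single i 1) 1 := by
  rw [monomial_sum_one]
  rfl

theorem sum_single_apply [DecidableEq I] (S : Finset I) (j : I) :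
    (∑ i ∈ S, Finsupp.single i 1 : I →₀ ℕ) j = if j ∈ S then 1 else 0 := by
  simp [Finsupp.finsetSum_apply, Finsupp.single_apply]

theorem sum_single_le_iff {S : Finset I} {s : I →₀ ℕ} :
    (∑ i ∈ S, Finsupp.single i 1 : I →₀ ℕ) ≤ s ↔ S ⊆ s.support := by
  classical
  rw [Finsupp.le_def]
  simp only [sum_single_apply]
  constructor
  · intro h i hi
    have := h i
    rw [if_pos hi] at this
    rw [Finsupp.mem_support_iff]
    omega
  · intro h i
    split_ifs with hi
    · have := Finsupp.mem_support_iff.1 (h hi)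
      omega
    · exact Nat.zero_le _

/-- A polynomial lies in the face ideal exactly if no monomial of it is supported on a face. -/
theorem mem_monomialIdeal {m : Finset I → Prop} (hm : IsComplex m) {p : MvPolynomial I ℝ} :
    p ∈ monomialIdeal m ↔ ∀ s ∈ p.support, ¬ m s.support := by
  have hset : {p : MvPolynomial I ℝ | ∃ S : Finset I, ¬ m S ∧ p = ∏ i ∈ S, X i} =
      (fun s => monomial s (1 : ℝ)) '' {s | ∃ S : Finset I, ¬ m S ∧
        s = ∑ i ∈ S, Finsupp.single i 1} := by
    ext p
    constructor
    · rintro ⟨S, hS, rfl⟩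
      exact ⟨_, ⟨S, hS, rfl⟩, (prod_X_eq_monomial S).symm⟩
    · rintro ⟨_, ⟨S, hS, rfl⟩, rfl⟩
      exact ⟨S, hS, (prod_X_eq_monomial S).symm⟩
  rw [monomialIdeal, hset, mem_ideal_span_monomial_image]
  refine forall₂_congr fun s _ => ?_
  constructor
  · rintro ⟨_, ⟨S, hS, rfl⟩, hle⟩ h
    exact hS (hm (sum_single_le_iff.1 hle) h)
  · intro h
    exact ⟨_, ⟨s.support, h, rfl⟩, sum_single_le_iff.2 subset_rfl⟩

theorem monomialIdeal_eq_top {m : Finset I → Prop} (h : ∀ S, ¬ m S) : monomialIdeal m = ⊤ := by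
  rw [Ideal.eq_top_iff_one]
  simpa using prod_X_mem_monomialIdeal (h ∅)

theorem mem_support_prod_X_mul [DecidableEq I] {S : Finset I} {p : MvPolynomial I ℝ}
    {s : I →₀ ℕ} (hs : s ∈ p.support) :
    ∃ t ∈ ((∏ i ∈ S, X i) * p).support, t.support = S ∪ s.support := by
  refine ⟨(∑ i ∈ S, Finsupp.single i 1) + s, ?_, ?_⟩
  · rw [mem_support_iff, prod_X_eq_monomial, coeff_monomial_mul, one_mul]
    exact mem_support_iff.1 hs
  · ext j
    simp only [Finsupp.mem_support_iff, Finsupp.add_apply, sum_single_apply, Finset.mem_union]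
    split_ifs with h <;> simp [h]

/-- `m'` arises from the complex `m` by adding the facet `b`, the new faces being those that
contain the restriction set `G`. -/
structure ShellingStep (m m' : Finset I → Prop) (b G : Finset I) : Prop where
  isComplex : IsComplex m
  isComplex' : IsComplex m'
  subset : G ⊆ b
  not_of_subset : ∀ S, G ⊆ S → ¬ m S
  iff : ∀ S, m' S ↔ m S ∨ G ⊆ S ∧ S ⊆ b

namespace ShellingStep

variable {m m' : Finset I → Prop} {b G : Finset I}

theorem imp (h : ShellingStep m m' b G) (S : Finset I) (hS : m S) : m' S :=
  (h.iff S).2 (Or.inl hS)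

theorem monomialIdeal_eq (h : ShellingStep m m' b G) :
    monomialIdeal m = monomialIdeal m' ⊔ Ideal.span {∏ i ∈ G, X i} := by
  classical
  apply le_antisymm
  · refine Ideal.span_le.2 ?_
    rintro p ⟨S, hS, rfl⟩
    by_cases hS' : m' S
    · refine Ideal.mem_sup_right ?_
      obtain hGS | hGS := (h.iff S).1 hS'
      · exact absurd hGS hS
      · exact Ideal.mem_span_singleton.2 (Finset.prod_dvd_prod_of_subset _ _ _ hGS.1)
    · exact Ideal.mem_sup_left (prod_X_mem_monomialIdeal hS')
  · refine sup_le (monomialIdeal_anti h.imp) ?_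
    rw [Ideal.span_singleton_le_iff_mem]
    exact prod_X_mem_monomialIdeal (h.not_of_subset G subset_rfl)

theorem mul_mem_iff (h : ShellingStep m m' b G) (x : MvPolynomial I ℝ) :
    (∏ i ∈ G, X i) * x ∈ monomialIdeal m' ↔
      x ∈ Ideal.span (X '' {i | i ∉ b} : Set (MvPolynomial I ℝ)) := by
  classical
  constructor
  · intro hx
    rw [mem_ideal_span_X_image]
    intro s hs
    obtain ⟨t, ht, hts⟩ := mem_support_prod_X_mul (S := G) hs
    have := (mem_monomialIdeal h.isComplex').1 hx t ht
    rw [hts, h.iff] at this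
    by_contra! hb
    refine this (Or.inr ⟨Finset.subset_union_left, Finset.union_subset h.subset fun i hi => ?_⟩)
    by_contra hib
    exact Finsupp.mem_support_iff.1 hi (hb i hib)
  · intro hx
    suffices hle : Ideal.span (X '' {i | i ∉ b} : Set (MvPolynomial I ℝ)) ≤
        Submodule.comap (LinearMap.mulLeft (MvPolynomial I ℝ) (∏ i ∈ G, X i))
          (monomialIdeal m') from hle hx
    refine Ideal.span_le.2 ?_
    rintro _ ⟨i, hi, rfl⟩
    change (∏ i ∈ G, X i) * X i ∈ monomialIdeal m'
    rw [mul_comm, ← Finset.prod_insert (fun hG => hi (h.subset hG))]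
    refine prod_X_mem_monomialIdeal fun hm' => ?_
    rcases (h.iff _).1 hm' with h₁ | h₁
    · exact h.not_of_subset _ (Finset.subset_insert _ _) h₁
    · exact hi (h₁.2 (Finset.mem_insert_self _ _))

/-- Passing to stars: if `Z` lies in the new facet, the step induces a step on the stars of
`Z`. -/
theorem link [DecidableEq I] (h : ShellingStep m m' b G) {Z : Finset I} (hZ : Z ⊆ b) :
    ShellingStep (fun S => m (S ∪ Z)) (fun S => m' (S ∪ Z)) b (G \ Z) where
  isComplex _ _ hST hT := h.isComplex (Finset.union_subset_union_left hST) hT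
  isComplex' _ _ hST hT := h.isComplex' (Finset.union_subset_union_left hST) hT
  subset := Finset.sdiff_subset.trans h.subset
  not_of_subset S hS := h.not_of_subset _ (by
    rw [Finset.union_comm]
    exact sdiff_le_iff.1 hS)
  iff S := by
    have hG : G ⊆ S ∪ Z ↔ G \ Z ⊆ S := by
      rw [Finset.union_comm]
      exact sdiff_le_iff.symm
    rw [h.iff, hG]
    simp [Finset.union_subset_iff, hZ]

theorem link_iff_of_not_subset [DecidableEq I] (h : ShellingStep m m' b G) {Z : Finset I}
    (hZ : ¬ Z ⊆ b) (S : Finset I) : m' (S ∪ Z) ↔ m (S ∪ Z) := by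
  rw [h.iff]
  refine or_iff_left fun h' => hZ (Finset.subset_union_right.trans h'.2)

end ShellingStep

/-- Complexes built from the empty complex by adding facets `b` with restriction sets `G`
subject to `R b G`. -/
inductive Shellable (R : Finset I → Finset I → Prop) : (Finset I → Prop) → Prop
  | empty {m : Finset I → Prop} (h : ∀ S, ¬ m S) : Shellable R m
  | step {m m' : Finset I → Prop} {b G : Finset I} (hm : Shellable R m) (hR : R b G)
      (h : ShellingStep m m' b G) : Shellable R m'

theorem Shellable.link [DecidableEq I] {R : Finset I → Finset I → Prop} {m : Finset I → Prop}
    (hR : ∀ b G G', G' ⊆ G → R b G → R b G') (h : Shellable R m) (Z : Finset I) :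
    Shellable R (fun S => m (S ∪ Z)) := by
  induction h with
  | empty h => exact .empty fun S => h _
  | @step _ _ b _ _ hbG h ih =>
    by_cases hZ : Z ⊆ b
    · exact .step ih (hR _ _ _ Finset.sdiff_subset hbG) (h.link hZ)
    · convert ih using 2
      rw [h.link_iff_of_not_subset hZ]

variable {θ : ℕ → MvPolynomial I ℝ} {d : ℕ} {R : Finset I → Finset I → Prop}
  {m : Finset I → Prop}

theorem Shellable.regularMod
    (hθ : ∀ b G, R b G → RegularMod θ d (Ideal.span (X '' {i | i ∉ b})))
    (h : Shellable R m) : RegularMod θ d (monomialIdeal m) := by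
  induction h with
  | empty h =>
    rw [monomialIdeal_eq_top h]
    exact regularMod_top
  | step _ hbG h ih => exact RegularMod.of_colon h.monomialIdeal_eq h.mul_mem_iff ih (hθ _ _ hbG)

end MonomialIdeal

/-! ### Gluing along the stars of vertices in a shellable complex -/

section Gluing

open MvPolynomial

variable {I : Type*} {θ : ℕ → MvPolynomial I ℝ} {d : ℕ} {R : Finset I → Finset I → Prop}

namespace ShellingStep

variable {m m' : Finset I → Prop} {b G : Finset I}

theorem exists_sub_mem (h : ShellingStep m m' b G) {K : Ideal (MvPolynomial I ℝ)}
    {x : MvPolynomial I ℝ} (hx : x ∈ monomialIdeal m ⊔ K) :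
    ∃ c, x - (∏ i ∈ G, X i) * c ∈ monomialIdeal m' ⊔ K := by
  rw [h.monomialIdeal_eq, sup_assoc, sup_comm, sup_assoc, Ideal.mem_span_singleton_sup] at hx
  obtain ⟨c, t, ht, rfl⟩ := hx
  rw [sup_comm] at ht
  exact ⟨c, by convert ht using 1; ring⟩

theorem mul_mem (h : ShellingStep m m' b G) {K : Ideal (MvPolynomial I ℝ)}
    {x : MvPolynomial I ℝ}
    (hx : x ∈ Ideal.span (X '' {i | i ∉ b} : Set (MvPolynomial I ℝ)) ⊔ K) :
    (∏ i ∈ G, X i) * x ∈ monomialIdeal m' ⊔ K := by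
  obtain ⟨a, ha, c, hc, rfl⟩ := Submodule.mem_sup.1 hx
  rw [mul_add]
  exact add_mem (Ideal.mem_sup_left ((h.mul_mem_iff a).2 ha))
    (Ideal.mem_sup_right (Ideal.mul_mem_left _ _ hc))

end ShellingStep

variable {m : Finset I → Prop} [DecidableEq I]

theorem monomialIdeal_le_link (hm : IsComplex m) (Z : Finset I) :
    monomialIdeal m ≤ monomialIdeal (fun S => m (S ∪ Z)) :=
  monomialIdeal_anti fun _ hS => hm Finset.subset_union_left hS

variable {T : Set I}

/-- If every facet of a shelling has a vertex in `T` outside its restriction set, then the face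
ring, also modulo a regular sequence, embeds into the product of the face rings of the stars of
the vertices in `T`. -/
theorem Shellable.mem_of_forall_mem_star
    (hθ : ∀ b G, R b G → RegularMod θ d (Ideal.span (X '' {i | i ∉ b})))
    (hR : ∀ b G G', G' ⊆ G → R b G → R b G')
    (hT : ∀ b G, R b G → ∃ i ∈ T, i ∈ b ∧ i ∉ G)
    (h : Shellable R m) {k : ℕ} (hk : k ≤ d) {x : MvPolynomial I ℝ}
    (hx : ∀ i ∈ T, x ∈ monomialIdeal (fun S => m (S ∪ {i})) ⊔ initialIdeal θ k) :
    x ∈ monomialIdeal m ⊔ initialIdeal θ k := by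
  induction h generalizing x with
  | empty h =>
    rw [monomialIdeal_eq_top h]
    simp
  | @step m m' b G hm hbG h ih =>
    have hlink : ∀ Z : Finset I, monomialIdeal (fun S => m' (S ∪ Z)) ≤
        monomialIdeal (fun S => m (S ∪ Z)) := fun Z => monomialIdeal_anti fun S => h.imp _
    obtain ⟨c, hc⟩ := h.exists_sub_mem
      (ih fun i hi => Ideal.mem_sup_of_le_left (hlink {i}) (hx i hi))
    obtain ⟨i, hiT, hib, hiG⟩ := hT _ _ hbG
    -- restricting to the star of `i` keeps the restriction set, so it determines `c` modulo `P`
    have hi := h.link (Z := {i}) (by simpa using hib)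
    rw [Finset.sdiff_singleton_eq_erase, Finset.erase_eq_of_notMem hiG] at hi
    have hcP := RegularMod.mem_of_mul_mem hi.monomialIdeal_eq (fun x => (hi.mul_mem_iff x).1)
      ((hm.link hR {i}).regularMod hθ) hk (x := c) (by
        convert sub_mem (hx i hiT)
          (Ideal.mem_sup_of_le_left (monomialIdeal_le_link h.isComplex' {i}) hc) using 1
        ring)
    convert add_mem hc (h.mul_mem hcP) using 1
    ring

/-- If every facet of a shelling has a vertex in `T` outside its restriction set, then elements
of the face rings of the stars of the vertices in `T` that agree on the intersections of stars
come from a common element; this also holds modulo a regular sequence. -/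
theorem Shellable.exists_forall_sub_mem_star
    (hθ : ∀ b G, R b G → RegularMod θ d (Ideal.span (X '' {i | i ∉ b})))
    (hR : ∀ b G G', G' ⊆ G → R b G → R b G')
    (hT : ∀ b G, R b G → ∃ i ∈ T, i ∈ b ∧ i ∉ G)
    (h : Shellable R m) {k : ℕ} (hk : k ≤ d) (x : I → MvPolynomial I ℝ)
    (hx : ∀ i ∈ T, ∀ j ∈ T,
      x i - x j ∈ monomialIdeal (fun S => m (S ∪ {i, j})) ⊔ initialIdeal θ k) :
    ∃ y, ∀ i ∈ T, y - x i ∈ monomialIdeal (fun S => m (S ∪ {i})) ⊔ initialIdeal θ k := by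
  induction h with
  | empty h =>
    refine ⟨0, fun i _ => ?_⟩
    rw [monomialIdeal_eq_top fun S => h _]
    simp
  | @step m m' b G hm hbG h ih =>
    have hlink : ∀ Z : Finset I, monomialIdeal (fun S => m' (S ∪ Z)) ≤
        monomialIdeal (fun S => m (S ∪ Z)) := fun Z => monomialIdeal_anti fun S => h.imp _
    obtain ⟨y, hy⟩ := ih fun i hi j hj => Ideal.mem_sup_of_le_left (hlink {i, j}) (hx i hi j hj)
    obtain ⟨i₀, hiT, hib, hiG⟩ := hT _ _ hbG
    have hi₀ := h.link (Z := {i₀}) (by simpa using hib)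
    rw [Finset.sdiff_singleton_eq_erase, Finset.erase_eq_of_notMem hiG] at hi₀
    -- correct `y` by a multiple of `u_G` so that it restricts correctly to the star of `i₀`
    obtain ⟨c, hc⟩ := hi₀.exists_sub_mem (hy i₀ hiT)
    have huG : (∏ i ∈ G, X i : MvPolynomial I ℝ) * c ∈ monomialIdeal m :=
      Ideal.mul_mem_right _ _ (prod_X_mem_monomialIdeal (h.not_of_subset G subset_rfl))
    have hy' : ∀ i ∈ T, y - (∏ i ∈ G, X i) * c - x i ∈
        monomialIdeal (fun S => m (S ∪ {i})) ⊔ initialIdeal θ k := by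
      intro i hi
      convert sub_mem (hy i hi)
        (Ideal.mem_sup_left (monomialIdeal_le_link h.isComplex {i} huG)) using 1
      ring
    have hy₀ : y - (∏ i ∈ G, X i) * c - x i₀ ∈
        monomialIdeal (fun S => m' (S ∪ {i₀})) ⊔ initialIdeal θ k := by
      convert hc using 1
      ring
    refine ⟨y - (∏ i ∈ G, X i) * c, fun i hi => ?_⟩
    by_cases hib' : i ∈ b
    · have hi' := h.link (Z := {i}) (by simpa using hib')
      have hi₂ := h.link (Z := {i₀, i}) (by
        rw [Finset.insert_subset_iff]
        exact ⟨hib, by simpa using hib'⟩)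
      have hG : G \ {i₀, i} = G \ {i} := by
        ext j
        simp only [Finset.mem_sdiff, Finset.mem_insert, Finset.mem_singleton, not_or]
        exact ⟨fun hj => ⟨hj.1, hj.2.2⟩, fun hj => ⟨hj.1, fun h => hiG (h ▸ hj.1), hj.2⟩⟩
      rw [hG] at hi₂
      obtain ⟨e, he⟩ := hi'.exists_sub_mem (hy' i hi)
      -- on the common star of `i₀` and `i` the error vanishes, and `u_{G \ {i}}` is still the
      -- generator of the new part there
      have hle₀ : monomialIdeal (fun S => m' (S ∪ {i₀})) ≤
          monomialIdeal (fun S => m' (S ∪ {i₀, i})) :=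
        monomialIdeal_anti fun S => h.isComplex' (Finset.union_subset_union_right (by simp))
      have hle : monomialIdeal (fun S => m' (S ∪ {i})) ≤
          monomialIdeal (fun S => m' (S ∪ {i₀, i})) :=
        monomialIdeal_anti fun S => h.isComplex' (Finset.union_subset_union_right (by simp))
      have heP := RegularMod.mem_of_mul_mem hi₂.monomialIdeal_eq
        (fun x => (hi₂.mul_mem_iff x).1) ((hm.link hR {i₀, i}).regularMod hθ) hk (x := e) (by
          convert sub_mem (add_mem (Ideal.mem_sup_of_le_left hle₀ hy₀) (hx i₀ hiT i hi))
            (Ideal.mem_sup_of_le_left hle he) using 1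
          ring)
      convert add_mem he (hi'.mul_mem heP) using 1
      ring
    · have hmi : (fun S => m' (S ∪ {i})) = fun S => m (S ∪ {i}) :=
        funext fun S => propext (h.link_iff_of_not_subset (by simpa using hib') S)
      rw [hmi]
      exact hy' i hi

end Gluing

namespace PolarizedArrangement

/-! ### Coordinates on `V` and regular sequences of linear forms -/

section LinearForms

open MvPolynomial

variable {I : Type*} [Fintype I] (𝒱 : PolarizedArrangement I)

/-- The linear form `∑ c_i u_i`. -/
noncomputable def linearForm (ι : Type*) [Fintype ι] : (ι → ℝ) →ₗ[ℝ] MvPolynomial ι ℝ :=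
  Fintype.linearCombination ℝ X

theorem linearForm_apply {ι : Type*} [Fintype ι] (c : ι → ℝ) :
    linearForm ι c = ∑ i, C (c i) * X i := by
  simp [linearForm, Fintype.linearCombination_apply, smul_eq_C_mul]

theorem linearForm_single {ι : Type*} [Fintype ι] [DecidableEq ι] (i : ι) :
    linearForm ι (Pi.single i 1) = X i := by
  simp [linearForm]

/-- `dim V`. -/
noncomputable abbrev dim : ℕ := Module.finrank ℝ 𝒱.V

/-- The linear forms given by the members of a basis of `V`, continued by zero. -/
noncomputable def basisForm (j : ℕ) : MvPolynomial I ℝ :=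
  if h : j < 𝒱.dim then linearForm I (Module.finBasis ℝ 𝒱.V ⟨j, h⟩ : 𝒱.V) else 0

theorem basisForm_fin (j : Fin 𝒱.dim) :
    𝒱.basisForm j = linearForm I (Module.finBasis ℝ 𝒱.V j : 𝒱.V) := by
  simp [basisForm]

theorem initialIdeal_basisForm : initialIdeal 𝒱.basisForm 𝒱.dim = 𝒱.linearIdeal := by
  apply le_antisymm
  · refine Ideal.span_le.2 ?_
    rintro _ ⟨j, hj, rfl⟩
    refine Ideal.subset_span ⟨_, (Module.finBasis ℝ 𝒱.V ⟨j, hj⟩).2, ?_⟩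
    rw [← linearForm_apply]
    exact 𝒱.basisForm_fin ⟨j, hj⟩
  · refine Ideal.span_le.2 ?_
    rintro _ ⟨v, hv, rfl⟩
    rw [← linearForm_apply]
    have hv' : v = ((∑ j, (Module.finBasis ℝ 𝒱.V).repr ⟨v, hv⟩ j •
        Module.finBasis ℝ 𝒱.V j : 𝒱.V) : I → ℝ) := by
      rw [Module.Basis.sum_repr]
    rw [hv', Submodule.coe_sum, map_sum]
    refine sum_mem fun j _ => ?_
    rw [Submodule.coe_smul, map_smul, ← basisForm_fin, smul_eq_C_mul]
    exact Ideal.mul_mem_left _ _ (Ideal.subset_span ⟨j, j.2, rfl⟩)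

/-- A set `b` of coordinates restricting to a basis of `V^*`. -/
structure IsBasis (b : Finset I) : Prop where
  eq_zero : ∀ y ∈ 𝒱.V, (∀ i ∈ b, y i = 0) → y = 0
  card_eq : b.card = 𝒱.dim

variable {𝒱}

theorem IsBasis.exists_linearMap {b : Finset I} (hb : 𝒱.IsBasis b) :
    ∃ L : (I → ℝ) →ₗ[ℝ] 𝒱.V, ∀ c, ∀ i ∈ b, (L c : I → ℝ) i = c i := by
  let res : (I → ℝ) →ₗ[ℝ] (b → ℝ) := LinearMap.funLeft ℝ ℝ Subtype.val
  have hinj : Function.Injective (res ∘ₗ 𝒱.V.subtype) := by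
    rw [← LinearMap.ker_eq_bot, LinearMap.ker_eq_bot']
    intro y hy
    exact Subtype.ext (hb.eq_zero y y.2 fun i hi => congrFun hy ⟨i, hi⟩)
  let e := LinearEquiv.ofInjectiveOfFinrankEq (res ∘ₗ 𝒱.V.subtype) hinj (by
    rw [Module.finrank_fintype_fun_eq_card, Fintype.card_coe, hb.card_eq])
  refine ⟨e.symm.toLinearMap ∘ₗ res, fun c i hi => ?_⟩
  exact congrFun (e.apply_symm_apply (res c)) ⟨i, hi⟩

/-- Modulo the variables outside a basis `b`, the polynomial ring becomes `Sym V`, on which a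
basis of `V` is a regular sequence. -/
theorem IsBasis.regularMod {b : Finset I} (hb : 𝒱.IsBasis b) :
    RegularMod 𝒱.basisForm 𝒱.dim (Ideal.span (X '' {i | i ∉ b})) := by
  classical
  obtain ⟨L, hL⟩ := hb.exists_linearMap
  set P : Ideal (MvPolynomial I ℝ) := Ideal.span (X '' {i | i ∉ b})
  let B := Module.finBasis ℝ 𝒱.V
  let ψ : MvPolynomial I ℝ →ₐ[ℝ] MvPolynomial (Fin 𝒱.dim) ℝ :=
    aeval fun i => linearForm _ (B.repr (L (Pi.single i 1)))
  let σ : MvPolynomial (Fin 𝒱.dim) ℝ →ₐ[ℝ] MvPolynomial I ℝ := aeval fun j => 𝒱.basisForm j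
  have hψlin : ∀ c, ψ (linearForm I c) = linearForm _ (B.repr (L c)) := by
    intro c
    have : ψ.toLinearMap ∘ₗ linearForm I =
        linearForm _ ∘ₗ Finsupp.lcoeFun ∘ₗ B.repr.toLinearMap ∘ₗ L := by
      refine LinearMap.pi_ext' fun i => LinearMap.ext_ring ?_
      change ψ (linearForm I (Pi.single i 1)) = linearForm _ (B.repr (L (Pi.single i 1)))
      rw [linearForm_single, aeval_X]
    exact LinearMap.congr_fun this c
  have hLV : ∀ y : 𝒱.V, L y = y := fun y => by
    rw [← sub_eq_zero, ← Submodule.coe_eq_zero]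
    refine hb.eq_zero _ (Submodule.coe_mem _) fun i hi => ?_
    simp [hL _ i hi]
  have hψθ : ∀ j (hj : j < 𝒱.dim), ψ (𝒱.basisForm j) = X ⟨j, hj⟩ := by
    intro j hj
    rw [𝒱.basisForm_fin ⟨j, hj⟩, hψlin, hLV, B.repr_self, ← linearForm_single,
      Finsupp.single_eq_pi_single]
  have hσlin : ∀ c : Fin 𝒱.dim → ℝ, σ (linearForm _ c) = linearForm I (∑ j, c j • B j : 𝒱.V) := by
    intro c
    rw [linearForm_apply, map_sum, Submodule.coe_sum, map_sum]
    refine Finset.sum_congr rfl fun j _ => ?_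
    rw [map_mul, aeval_X, basisForm_fin, Submodule.coe_smul, map_smul, smul_eq_C_mul]
    congr 1
    exact aeval_C _ _
  have hP : ∀ c : I → ℝ, (∀ i ∈ b, c i = 0) → linearForm I c ∈ P := by
    intro c hc
    rw [linearForm_apply]
    refine sum_mem fun i _ => ?_
    by_cases hi : i ∈ b
    · rw [hc i hi]
      simp
    · exact Ideal.mul_mem_left _ _ (Ideal.subset_span ⟨i, hi, rfl⟩)
  have hσψ : ∀ x, x - σ (ψ x) ∈ P := by
    have : (Ideal.Quotient.mkₐ ℝ P).comp (σ.comp ψ) = Ideal.Quotient.mkₐ ℝ P := by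
      refine algHom_ext fun i => ?_
      refine Eq.symm (Ideal.Quotient.eq.2 ?_)
      change X i - σ (ψ (X i)) ∈ P
      rw [aeval_X, hσlin, B.sum_repr, ← linearForm_single, ← map_sub]
      refine hP _ fun j hj => ?_
      simp [hL _ j hj]
    intro x
    exact Ideal.Quotient.eq.1 (AlgHom.congr_fun this x).symm
  have hψP : P ≤ RingHom.ker ψ := by
    refine Ideal.span_le.2 ?_
    rintro _ ⟨i, hi, rfl⟩
    change ψ (X i) = 0
    rw [← linearForm_single, hψlin]
    have : L (Pi.single i 1) = 0 := by
      rw [← Submodule.coe_eq_zero]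
      refine hb.eq_zero _ (Submodule.coe_mem _) fun j hj => ?_
      rw [hL _ j hj, Pi.single_eq_of_ne]
      rintro rfl
      exact hi hj
    rw [this]
    simp
  intro k hk x hx
  have hx' : X ⟨k, hk⟩ * ψ x ∈ Ideal.span (X '' {j : Fin 𝒱.dim | (j : ℕ) < k} :
      Set (MvPolynomial (Fin 𝒱.dim) ℝ)) := by
    rw [← hψθ k hk, ← map_mul]
    obtain ⟨a, ha, c, hc, hac⟩ := Submodule.mem_sup.1 hx
    rw [← hac, map_add, show ψ a = 0 from hψP ha, zero_add]
    suffices hle : initialIdeal 𝒱.basisForm k ≤ Ideal.comap ψ (Ideal.span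
        (X '' {j : Fin 𝒱.dim | (j : ℕ) < k})) from hle hc
    refine Ideal.span_le.2 ?_
    rintro _ ⟨j, hj, rfl⟩
    rw [SetLike.mem_coe, Ideal.mem_comap, hψθ j (lt_trans hj hk)]
    exact Ideal.subset_span ⟨_, hj, rfl⟩
  have hx'' : ψ x ∈ Ideal.span (X '' {j : Fin 𝒱.dim | (j : ℕ) < k} :
      Set (MvPolynomial (Fin 𝒱.dim) ℝ)) := by
    rw [mem_ideal_span_X_image] at hx' ⊢
    intro s hs
    obtain ⟨j, hj, hsj⟩ := hx' (Finsupp.single ⟨k, hk⟩ 1 + s) (by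
      rw [mem_support_iff, coeff_X_mul]
      exact mem_support_iff.1 hs)
    refine ⟨j, hj, ?_⟩
    have hne : (⟨k, hk⟩ : Fin 𝒱.dim) ≠ j := by
      rintro rfl
      exact lt_irrefl k hj
    simpa [Finsupp.single_eq_of_ne' hne] using hsj
  have hσx : σ (ψ x) ∈ initialIdeal 𝒱.basisForm k := by
    suffices hle : Ideal.span (X '' {j : Fin 𝒱.dim | (j : ℕ) < k}) ≤
        Ideal.comap σ (initialIdeal 𝒱.basisForm k) from hle hx''
    refine Ideal.span_le.2 ?_
    rintro _ ⟨j, hj, rfl⟩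
    rw [SetLike.mem_coe, Ideal.mem_comap, aeval_X]
    exact Ideal.subset_span ⟨_, hj, rfl⟩
  have := add_mem (Ideal.mem_sup_left (T := initialIdeal 𝒱.basisForm k) (hσψ x))
    (Ideal.mem_sup_right hσx)
  rwa [sub_add_cancel] at this

end LinearForms

/-! ### Vertices of chambers -/

section Vertices

variable {I : Type*} [Fintype I] {𝒱 : PolarizedArrangement I}

theorem sub_mem_of_mem_affineSpace {x y : I → ℝ} (hx : x ∈ 𝒱.affineSpace)
    (hy : y ∈ 𝒱.affineSpace) : x - y ∈ 𝒱.V := by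
  rw [← Submodule.Quotient.eq]
  exact Eq.trans hx (Eq.symm hy)

theorem add_mem_affineSpace {x y : I → ℝ} (hx : x ∈ 𝒱.affineSpace) (hy : y ∈ 𝒱.V) :
    x + y ∈ 𝒱.affineSpace := by
  have : 𝒱.V.mkQ y = 0 := by simpa using hy
  change 𝒱.V.mkQ (x + y) = 𝒱.η
  rw [map_add, this, add_zero]
  exact hx

omit [Fintype I] in
theorem sign_mul_self (α : I → ℤˣ) (i : I) : ((α i : ℤ) : ℝ) * ((α i : ℤ) : ℝ) = 1 := by
  rcases Int.units_eq_one_or (α i) with h | h <;> simp [h]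

omit [Fintype I] in
theorem sign_mul_ne_zero {α : I → ℤˣ} {x : I → ℝ} {i : I} (h : x i ≠ 0) :
    ((α i : ℤ) : ℝ) * x i ≠ 0 := by
  refine mul_ne_zero (fun h0 => ?_) h
  have := sign_mul_self α i
  simp [h0] at this

/-- The linear functional `x ↦ ∑ a_i α(i) x_i`. For positive weights `a` it is nonnegative and
proper on the chamber of `α`. -/
noncomputable def height (a : I → ℝ) (α : I → ℤˣ) : (I → ℝ) →ₗ[ℝ] ℝ :=
  Fintype.linearCombination ℝ (fun i => a i * ((α i : ℤ) : ℝ))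

theorem height_apply (a : I → ℝ) (α : I → ℤˣ) (x : I → ℝ) :
    height a α x = ∑ i, a i * (((α i : ℤ) : ℝ) * x i) := by
  simp only [height, Fintype.linearCombination_apply, smul_eq_mul]
  exact Finset.sum_congr rfl fun i _ => by ring

theorem height_pos {a : I → ℝ} (ha : ∀ i, 0 < a i) {α : I → ℤˣ} {y : I → ℝ} (hy : y ≠ 0)
    (h : ∀ i, 0 ≤ ((α i : ℤ) : ℝ) * y i) : 0 < height a α y := by
  obtain ⟨i, hi⟩ := Function.ne_iff.1 hy
  rw [height_apply]
  refine Finset.sum_pos' (fun i _ => mul_nonneg (ha i).le (h i)) ⟨i, Finset.mem_univ i, ?_⟩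
  exact mul_pos (ha i) (lt_of_le_of_ne (h i) (sign_mul_ne_zero hi).symm)

variable (𝒱) in
/-- A vertex of the chamber of `α`: a point at which the vanishing coordinates determine the
elements of `V`. -/
structure IsVertex (α : I → ℤˣ) (v : I → ℝ) : Prop where
  mem : v ∈ 𝒱.chamber α
  eq_zero : ∀ y ∈ 𝒱.V, (∀ i, v i = 0 → y i = 0) → y = 0

/-- Every point of a chamber can be moved to a vertex within the faces containing it, without
increasing the height. -/
theorem exists_isVertex_le {a : I → ℝ} (ha : ∀ i, 0 < a i) {α : I → ℤˣ} {x : I → ℝ}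
    (hx : x ∈ 𝒱.chamber α) :
    ∃ v, 𝒱.IsVertex α v ∧ (∀ i, x i = 0 → v i = 0) ∧ height a α v ≤ height a α x := by
  classical
  induction hn : (Finset.univ.filter fun i => x i ≠ 0).card using Nat.strong_induction_on
    generalizing x with
  | _ n ih =>
    subst hn
    by_cases hv : 𝒱.IsVertex α x
    · exact ⟨x, hv, fun _ h => h, le_rfl⟩
    obtain ⟨y, hyV, hxy, hy0, hle⟩ : ∃ y ∈ 𝒱.V, (∀ i, x i = 0 → y i = 0) ∧ y ≠ 0 ∧
        height a α y ≤ 0 := by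
      have : ∃ y ∈ 𝒱.V, (∀ i, x i = 0 → y i = 0) ∧ y ≠ 0 := by
        by_contra! h
        exact hv ⟨hx, h⟩
      obtain ⟨y, hyV, hxy, hy0⟩ := this
      rcases le_total (height a α y) 0 with h | h
      · exact ⟨y, hyV, hxy, hy0, h⟩
      · exact ⟨-y, neg_mem hyV, fun i hi => by simp [hxy i hi], neg_ne_zero.2 hy0,
          by rw [map_neg]; linarith⟩
    have hneg : (Finset.univ.filter fun i => ((α i : ℤ) : ℝ) * y i < 0).Nonempty := by
      by_contra h
      rw [Finset.not_nonempty_iff_eq_empty, Finset.filter_eq_empty_iff] at h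
      exact absurd (height_pos ha hy0 fun i => not_lt.1 (h (Finset.mem_univ i))) (not_lt.2 hle)
    -- move in the direction `y` until the first further coordinate vanishes
    obtain ⟨i₀, hi₀, hmin⟩ := Finset.exists_min_image _
      (fun i => ((α i : ℤ) : ℝ) * x i / -(((α i : ℤ) : ℝ) * y i)) hneg
    have hi₀' : ((α i₀ : ℤ) : ℝ) * y i₀ < 0 := (Finset.mem_filter.1 hi₀).2
    set t := ((α i₀ : ℤ) : ℝ) * x i₀ / -(((α i₀ : ℤ) : ℝ) * y i₀) with ht
    have ht0 : 0 ≤ t := div_nonneg (hx.2 i₀) (by linarith)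
    have hmem : x + t • y ∈ 𝒱.chamber α := by
      refine ⟨add_mem_affineSpace hx.1 (𝒱.V.smul_mem t hyV), fun i => ?_⟩
      rw [Pi.add_apply, Pi.smul_apply, smul_eq_mul]
      by_cases hi : ((α i : ℤ) : ℝ) * y i < 0
      · have := hmin i (Finset.mem_filter.2 ⟨Finset.mem_univ i, hi⟩)
        rw [le_div_iff₀ (by linarith)] at this
        linarith
      · have := mul_nonneg ht0 (not_lt.1 hi)
        have := hx.2 i
        linarith
    have hzero : (x + t • y) i₀ = 0 := by
      have h1 : ((α i₀ : ℤ) : ℝ) * (x + t • y) i₀ = 0 := by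
        rw [Pi.add_apply, Pi.smul_apply, smul_eq_mul]
        have := div_mul_cancel₀ (((α i₀ : ℤ) : ℝ) * x i₀) (neg_ne_zero.2 hi₀'.ne)
        rw [← ht] at this
        linear_combination -this
      by_contra h
      exact sign_mul_ne_zero h h1
    have hkeep : ∀ i, x i = 0 → (x + t • y) i = 0 := fun i hi => by simp [hi, hxy i hi]
    obtain ⟨v, hv, hxv, hvle⟩ := ih _ (Finset.card_lt_card (by
      rw [Finset.ssubset_iff_of_subset]
      · refine ⟨i₀, ?_, ?_⟩
        · simp only [Finset.mem_filter, Finset.mem_univ, true_and]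
          intro h
          rw [hxy i₀ h, mul_zero] at hi₀'
          exact lt_irrefl _ hi₀'
        · simpa using hzero
      · intro i hi
        simp only [Finset.mem_filter, Finset.mem_univ, true_and] at hi ⊢
        exact fun h => hi (hkeep i h))) hmem rfl
    refine ⟨v, hv, fun i hi => hxv i (hkeep i hi), hvle.trans ?_⟩
    rw [map_add, map_smul, smul_eq_mul]
    have := mul_nonpos_of_nonneg_of_nonpos ht0 hle
    linarith

/-- The set of vanishing coordinates of `x`. -/
noncomputable def zeroSet (x : I → ℝ) : Finset I := Finset.univ.filter fun i => x i = 0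

theorem mem_zeroSet {x : I → ℝ} {i : I} : i ∈ zeroSet x ↔ x i = 0 := by
  simp [zeroSet]

/-- By genericity of `η`, the vanishing coordinates at a vertex form a basis. -/
theorem IsVertex.isBasis {α : I → ℤˣ} {v : I → ℝ} (hv : 𝒱.IsVertex α v) :
    𝒱.IsBasis (zeroSet v) := by
  have h0 : ∀ y ∈ 𝒱.V, (∀ i ∈ zeroSet v, y i = 0) → y = 0 := fun y hy h =>
    hv.eq_zero y hy fun i hi => h i (mem_zeroSet.2 hi)
  refine ⟨h0, le_antisymm ?_ ?_⟩
  · have h1 := 𝒱.η_generic v hv.mem.1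
    have h2 := Finset.card_filter_add_card_filter_not (s := (Finset.univ : Finset I))
      (fun i => v i = 0)
    rw [Finset.card_univ] at h2
    change (Finset.univ.filter fun i => v i = 0).card ≤ 𝒱.dim
    simp only [ne_eq] at h1
    unfold dim
    omega
  · let f : 𝒱.V →ₗ[ℝ] (zeroSet v → ℝ) := LinearMap.funLeft ℝ ℝ Subtype.val ∘ₗ 𝒱.V.subtype
    have hinj : Function.Injective f := by
      rw [← LinearMap.ker_eq_bot, LinearMap.ker_eq_bot']
      intro y hy
      exact Subtype.ext (h0 y y.2 fun i hi => congrFun hy ⟨i, hi⟩)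
    have := LinearMap.finrank_le_finrank_of_injective hinj
    rwa [Module.finrank_fintype_fun_eq_card, Fintype.card_coe] at this

theorem finite_isVertex (α : I → ℤˣ) : {v | 𝒱.IsVertex α v}.Finite := by
  refine Set.Finite.of_finite_image (f := zeroSet) (Set.toFinite _) ?_
  intro v hv w hw hvw
  rw [← sub_eq_zero]
  refine IsVertex.eq_zero hv _ (sub_mem_of_mem_affineSpace hv.mem.1 hw.mem.1) fun i hi => ?_
  have hi' : w i = 0 := mem_zeroSet.1 (hvw ▸ mem_zeroSet.2 hi)
  simp [hi, hi']

/-- Positive weights avoiding finitely many hyperplanes; they are found on the moment curve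
`t ↦ (1, t, t², …)`. -/
theorem exists_pos_weights {W : Set (I → ℝ)} (hW : W.Finite) (h0 : 0 ∉ W) :
    ∃ a : I → ℝ, (∀ i, 0 < a i) ∧ ∀ w ∈ W, ∑ i, a i * w i ≠ 0 := by
  classical
  let e := Fintype.equivFin I
  let p : (I → ℝ) → Polynomial ℝ := fun w =>
    ∑ i, Polynomial.C (w i) * Polynomial.X ^ (e i : ℕ)
  have hp : ∀ w ∈ W, p w ≠ 0 := by
    intro w hw h
    apply h0
    have : w = 0 := by
      funext i
      have hc : (p w).coeff (e i) = w i := by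
        simp only [p, Polynomial.finsetSum_coeff, Polynomial.coeff_C_mul,
          Polynomial.coeff_X_pow]
        rw [Finset.sum_eq_single i]
        · simp
        · intro j _ hj
          rw [if_neg, mul_zero]
          intro h
          exact hj (e.injective (Fin.ext h.symm))
        · simp
      rw [← hc, h]
      simp
    exact this ▸ hw
  have hfin : (⋃ w ∈ W, {t : ℝ | (p w).IsRoot t}).Finite :=
    hW.biUnion fun w hw => Polynomial.finite_setOfPred_isRoot (hp w hw)
  obtain ⟨t, ht, htW⟩ := ((Set.Ioi_infinite (0 : ℝ)).sdiff hfin).nonempty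
  refine ⟨fun i => t ^ (e i : ℕ), fun i => pow_pos ht _, fun w hw h => htW ?_⟩
  refine Set.mem_biUnion hw ?_
  change (p w).eval t = 0
  rw [← h]
  simp only [p, Polynomial.eval_finsetSum, Polynomial.eval_mul, Polynomial.eval_C,
    Polynomial.eval_pow, Polynomial.eval_X]
  exact Finset.sum_congr rfl fun i _ => mul_comm _ _

theorem exists_injOn_height (α : I → ℤˣ) :
    ∃ a : I → ℝ, (∀ i, 0 < a i) ∧ Set.InjOn (height a α) {v | 𝒱.IsVertex α v} := by
  have hfin := 𝒱.finite_isVertex α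
  obtain ⟨a, ha, h⟩ := exists_pos_weights
    (W := (fun p : (I → ℝ) × (I → ℝ) => fun i => ((α i : ℤ) : ℝ) * (p.1 i - p.2 i)) ''
      (({v | 𝒱.IsVertex α v} ×ˢ {v | 𝒱.IsVertex α v}) \ {p | p.1 = p.2}))
    (((hfin.prod hfin).subset Set.sdiff_subset).image _) (by
      rintro ⟨⟨v, w⟩, ⟨_, hne⟩, h⟩
      refine hne (funext fun i => ?_)
      by_contra hi
      exact sign_mul_ne_zero (α := α) (x := v - w) (i := i) (sub_ne_zero.2 hi) (congrFun h i))
  refine ⟨a, ha, fun v hv w hw hvw => ?_⟩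
  by_contra hne
  refine h _ ⟨(v, w), ⟨⟨hv, hw⟩, hne⟩, rfl⟩ ?_
  have := map_sub (height a α) v w
  rw [hvw, sub_self, height_apply] at this
  exact this

end Vertices

/-! ### Shelling of a chamber -/

section Shelling

variable {I : Type*} [Fintype I] {𝒱 : PolarizedArrangement I}

variable (𝒱) in
/-- The facet `b` is a basis, and every nonzero `y ∈ V` in the cone of `α` moves off some
hyperplane `H_i` with `i ∈ b` outside the restriction set `G`. -/
def ShellingCond (α : I → ℤˣ) (b G : Finset I) : Prop :=
  𝒱.IsBasis b ∧ ∀ y ∈ 𝒱.V, y ≠ 0 → (∀ i, 0 ≤ ((α i : ℤ) : ℝ) * y i) →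
    ∃ i, y i ≠ 0 ∧ i ∈ b ∧ i ∉ G

theorem ShellingCond.mono {α : I → ℤˣ} {b G G' : Finset I} (hG : G' ⊆ G)
    (h : 𝒱.ShellingCond α b G) : 𝒱.ShellingCond α b G' :=
  ⟨h.1, fun y hy hy0 hα => by
    obtain ⟨i, hi, hib, hiG⟩ := h.2 y hy hy0 hα
    exact ⟨i, hi, hib, fun hi => hiG (hG hi)⟩⟩

variable (𝒱) in
/-- The complex of those `S` for which `H_S` meets the chamber of `α` below height `t`. -/
def sublevelComplex (a : I → ℝ) (α : I → ℤˣ) (t : ℝ) (S : Finset I) : Prop :=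
  ∃ x ∈ 𝒱.chamber α, (∀ i ∈ S, x i = 0) ∧ height a α x < t

theorem isComplex_sublevelComplex (a : I → ℝ) (α : I → ℤˣ) (t : ℝ) :
    IsComplex (𝒱.sublevelComplex a α t) := by
  rintro S T hST ⟨x, hx, hT, ht⟩
  exact ⟨x, hx, fun i hi => hT i (hST hi), ht⟩

/-- A nonempty face has a vertex of least height. -/
theorem exists_isVertex_forall_le {a : I → ℝ} (ha : ∀ i, 0 < a i) {α : I → ℤˣ} {x : I → ℝ}
    {S : Finset I} (hx : x ∈ 𝒱.chamber α) (hS : ∀ i ∈ S, x i = 0) :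
    ∃ v, 𝒱.IsVertex α v ∧ (∀ i ∈ S, v i = 0) ∧
      ∀ z ∈ 𝒱.chamber α, (∀ i ∈ S, z i = 0) → height a α v ≤ height a α z := by
  obtain ⟨w, hw, hxw, _⟩ := exists_isVertex_le ha hx
  obtain ⟨v, ⟨hv, hvS⟩, hmin⟩ := Set.exists_min_image
    {v | 𝒱.IsVertex α v ∧ ∀ i ∈ S, v i = 0} (height a α)
    ((finite_isVertex α).subset fun v hv => hv.1) ⟨w, hw, fun i hi => hxw i (hS i hi)⟩
  refine ⟨v, hv, hvS, fun z hz hzS => ?_⟩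
  obtain ⟨u, hu, hzu, hle⟩ := exists_isVertex_le ha hz
  exact (hmin u ⟨hu, fun i hi => hzu i (hzS i hi)⟩).trans hle

/-- A vertex of a chamber stays in the chamber under small moves along `V` that respect the
signs of the coordinates vanishing at the vertex. -/
theorem exists_pos_add_smul_mem_chamber {α : I → ℤˣ} {v y : I → ℝ} (hv : v ∈ 𝒱.chamber α)
    (hy : y ∈ 𝒱.V) (h : ∀ i, v i = 0 → 0 ≤ ((α i : ℤ) : ℝ) * y i) :
    ∃ ε : ℝ, 0 < ε ∧ v + ε • y ∈ 𝒱.chamber α := by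
  have hev : ∀ i, ∀ᶠ ε : ℝ in nhdsWithin 0 (Set.Ioi 0),
      0 ≤ ((α i : ℤ) : ℝ) * (v i + ε * y i) := by
    intro i
    by_cases hi : v i = 0
    · filter_upwards [self_mem_nhdsWithin] with ε hε
      rw [hi, zero_add, mul_left_comm]
      exact mul_nonneg (le_of_lt hε) (h i hi)
    · have hpos : 0 < ((α i : ℤ) : ℝ) * v i :=
        lt_of_le_of_ne (hv.2 i) (sign_mul_ne_zero hi).symm
      have hcont : Continuous fun ε : ℝ => ((α i : ℤ) : ℝ) * (v i + ε * y i) := by fun_prop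
      have := hcont.tendsto 0
      simp only [zero_mul, add_zero] at this
      exact ((this.mono_left nhdsWithin_le_nhds).eventually (lt_mem_nhds hpos)).mono
        fun _ => le_of_lt
  obtain ⟨ε, hε, hε0⟩ := ((Filter.eventually_all.2 hev).and self_mem_nhdsWithin).exists
  exact ⟨ε, hε0, add_mem_affineSpace hv.1 (𝒱.V.smul_mem ε hy), hε⟩

/-- Passing a vertex `v` of a chamber in order of height is a shelling step: the new faces are
those having `v` as their lowest vertex. The restriction set consists of those `i` for which the
edge leaving `H_i` at `v` goes down. -/
theorem exists_shellingStep {a : I → ℝ} (ha : ∀ i, 0 < a i) {α : I → ℤˣ}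
    (hinj : Set.InjOn (height a α) {v | 𝒱.IsVertex α v}) {t : ℝ} {v : I → ℝ}
    (hv : 𝒱.IsVertex α v) (hvt : height a α v < t)
    (hmax : ∀ w, 𝒱.IsVertex α w → height a α w < t → height a α w ≤ height a α v) :
    ∃ b G, 𝒱.ShellingCond α b G ∧
      ShellingStep (𝒱.sublevelComplex a α (height a α v)) (𝒱.sublevelComplex a α t) b G := by
  classical
  obtain ⟨L, hL⟩ := hv.isBasis.exists_linearMap
  let e : I → 𝒱.V := fun i => L (Pi.single i ((α i : ℤ) : ℝ))
  have he : ∀ i, ∀ j ∈ zeroSet v, (e i : I → ℝ) j = if j = i then ((α i : ℤ) : ℝ) else 0 := by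
    intro i j hj
    rw [hL _ j hj, Pi.single_apply]
  -- the edge directions `e i` form the basis of `V` dual to the coordinates in `zeroSet v`
  have hexp : ∀ y ∈ 𝒱.V, height a α y =
      ∑ i ∈ zeroSet v, (((α i : ℤ) : ℝ) * y i) * height a α (e i) := by
    intro y hy
    have : y = ∑ i ∈ zeroSet v, (((α i : ℤ) : ℝ) * y i) • (e i : I → ℝ) := by
      rw [← sub_eq_zero]
      refine hv.isBasis.eq_zero _ (sub_mem hy (sum_mem fun i _ =>
        𝒱.V.smul_mem _ (e i).2)) fun j hj => ?_
      rw [Pi.sub_apply, Finset.sum_apply, Finset.sum_eq_single j]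
      · rw [Pi.smul_apply, he j j hj, if_pos rfl, smul_eq_mul, mul_right_comm, sign_mul_self,
          one_mul, sub_self]
      · intro i _ hij
        rw [Pi.smul_apply, he i j hj, if_neg (Ne.symm hij), smul_zero]
      · exact fun h => absurd hj h
    conv_lhs => rw [this]
    simp only [map_sum, map_smul, smul_eq_mul]
  let G := (zeroSet v).filter fun i => height a α (e i) < 0
  -- a face whose edges at `v` all go up has `v` as its lowest point
  have hlow : ∀ S, G ⊆ S → ∀ x ∈ 𝒱.chamber α, (∀ i ∈ S, x i = 0) →
      height a α v ≤ height a α x := by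
    intro S hGS x hx hxS
    have h1 := hexp _ (sub_mem_of_mem_affineSpace hx.1 hv.mem.1)
    rw [map_sub] at h1
    have h2 : 0 ≤ ∑ i ∈ zeroSet v, (((α i : ℤ) : ℝ) * (x - v) i) * height a α (e i) := by
      refine Finset.sum_nonneg fun i hi => ?_
      rw [Pi.sub_apply, mem_zeroSet.1 hi, sub_zero]
      by_cases hi' : height a α (e i) < 0
      · rw [hxS i (hGS (Finset.mem_filter.2 ⟨hi, hi'⟩))]
        simp
      · exact mul_nonneg (hx.2 i) (not_lt.1 hi')
    linarith
  refine ⟨zeroSet v, G, ⟨hv.isBasis, fun y hy hy0 hα => ?_⟩, ?_⟩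
  · have h1 := height_pos ha hy0 hα
    rw [hexp y hy] at h1
    obtain ⟨i, hi, hpos⟩ := Finset.exists_lt_of_sum_lt (f := fun _ => (0 : ℝ))
      (by simpa using h1)
    refine ⟨i, fun h => ?_, hi, fun hG => ?_⟩
    · simp [h] at hpos
    · have := mul_nonpos_of_nonneg_of_nonpos (hα i) (Finset.mem_filter.1 hG).2.le
      linarith
  · refine ⟨isComplex_sublevelComplex _ _ _, isComplex_sublevelComplex _ _ _,
      Finset.filter_subset _ _, ?_, fun S => ⟨?_, ?_⟩⟩
    · rintro S hGS ⟨x, hx, hxS, hlt⟩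
      exact absurd (hlow S hGS x hx hxS) (not_le.2 hlt)
    · rintro ⟨x, hx, hxS, hlt⟩
      obtain ⟨w, hw, hwS, hwmin⟩ := exists_isVertex_forall_le ha hx hxS
      rcases (hmax w hw ((hwmin x hx hxS).trans_lt hlt)).lt_or_eq with h | h
      · exact Or.inl ⟨w, hw.mem, hwS, h⟩
      · obtain rfl : w = v := hinj hw hv h
        refine Or.inr ⟨fun i hi => ?_, fun i hi => mem_zeroSet.2 (hwS i hi)⟩
        by_contra hiS
        obtain ⟨hib, hi⟩ := Finset.mem_filter.1 hi
        obtain ⟨ε, hε, hmem⟩ := exists_pos_add_smul_mem_chamber hw.mem (e i).2 fun j hj => by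
          rw [he i j (mem_zeroSet.2 hj)]
          split_ifs with hji
          · rw [hji, sign_mul_self]
            exact zero_le_one
          · simp
        have := hwmin _ hmem fun j hj => by
          have hj0 := hwS j hj
          have hji : j ≠ i := fun h => hiS (h ▸ hj)
          simp [hj0, he i j (mem_zeroSet.2 hj0), hji]
        rw [map_add, map_smul, smul_eq_mul] at this
        have := mul_neg_of_pos_of_neg hε hi
        linarith
    · rintro (⟨x, hx, hxS, hlt⟩ | ⟨_, hS⟩)
      · exact ⟨x, hx, hxS, hlt.trans hvt⟩
      · exact ⟨v, hv.mem, fun i hi => mem_zeroSet.1 (hS hi), hvt⟩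

theorem shellable_sublevelComplex {a : I → ℝ} (ha : ∀ i, 0 < a i) {α : I → ℤˣ}
    (hinj : Set.InjOn (height a α) {v | 𝒱.IsVertex α v}) (t : ℝ) :
    Shellable (𝒱.ShellingCond α) (𝒱.sublevelComplex a α t) := by
  have hfin : ∀ t, {v | 𝒱.IsVertex α v ∧ height a α v < t}.Finite := fun t =>
    (finite_isVertex α).subset fun v hv => hv.1
  induction hn : {v | 𝒱.IsVertex α v ∧ height a α v < t}.ncard using Nat.strong_induction_on
    generalizing t with
  | _ n ih =>
    subst hn
    rcases Set.eq_empty_or_nonempty {v | 𝒱.IsVertex α v ∧ height a α v < t} with h | h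
    · refine .empty ?_
      rintro S ⟨x, hx, -, hlt⟩
      obtain ⟨v, hv, -, hle⟩ := exists_isVertex_le ha hx
      exact Set.eq_empty_iff_forall_notMem.1 h v ⟨hv, hle.trans_lt hlt⟩
    · obtain ⟨v, ⟨hv, hvt⟩, hmax⟩ := Set.exists_max_image _ (height a α) (hfin t) h
      obtain ⟨b, G, hbG, hstep⟩ :=
        exists_shellingStep ha hinj hv hvt fun w hw hwt => hmax w ⟨hw, hwt⟩
      refine .step (ih _ (Set.ncard_lt_ncard ⟨?_, ?_⟩ (hfin t)) _ rfl) hbG hstep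
      · exact fun w hw => ⟨hw.1, hw.2.trans hvt⟩
      · exact fun hle => lt_irrefl _ (hle ⟨hv, hvt⟩).2

/-- The faces of a chamber form a shellable complex. -/
theorem shellable_chamber (α : I → ℤˣ) :
    Shellable (𝒱.ShellingCond α) (fun S => (𝒱.flat S ∩ 𝒱.chamber α).Nonempty) := by
  obtain ⟨a, ha, hinj⟩ := exists_injOn_height (𝒱 := 𝒱) α
  obtain ⟨M, hM⟩ := ((finite_isVertex (𝒱 := 𝒱) α).image (height a α)).bddAbove
  convert shellable_sublevelComplex ha hinj (M + 1) using 1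
  funext S
  refine propext ⟨?_, ?_⟩
  · rintro ⟨x, hxS, hx⟩
    obtain ⟨v, hv, hxv, -⟩ := exists_isVertex_le ha hx
    have : height a α v ≤ M := hM ⟨v, hv, rfl⟩
    exact ⟨v, hv.mem, fun i hi => hxv i (hxS.2 i hi), by linarith⟩
  · rintro ⟨x, hx, hxS, -⟩
    exact ⟨x, ⟨hx.1, hxS⟩, hx⟩

end Shelling

/-! ### Regions cut out by sign conditions -/

section Regions

variable {I : Type*} [Fintype I] {𝒱 : PolarizedArrangement I}

theorem faceIdeal_eq_monomialIdeal (D : Set (I → ℝ)) :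
    𝒱.faceIdeal D = monomialIdeal fun S => (𝒱.flat S ∩ D).Nonempty := by
  simp only [faceIdeal, monomialIdeal, Set.not_nonempty_iff_eq_empty]

theorem isComplex_flat_inter (D : Set (I → ℝ)) :
    IsComplex fun S => (𝒱.flat S ∩ D).Nonempty := by
  rintro S T hST ⟨x, ⟨hx, hT⟩, hD⟩
  exact ⟨x, ⟨hx, fun i hi => hT i (hST hi)⟩, hD⟩

theorem faceIdeal_eq_top {D : Set (I → ℝ)} (h : ¬ D.Nonempty) : 𝒱.faceIdeal D = ⊤ := by
  rw [faceIdeal_eq_monomialIdeal]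
  exact monomialIdeal_eq_top fun S hS => h (hS.mono Set.inter_subset_right)

variable (𝒱) in
/-- The points of `V_η` with nonnegative coordinates on `p` and nonpositive coordinates on `n`.
Coordinates in `p ∩ n` vanish, so every face of the arrangement is of this form with
`p ∪ n = I`. -/
def region (p n : Finset I) : Set (I → ℝ) :=
  {x | x ∈ 𝒱.affineSpace ∧ (∀ i ∈ p, 0 ≤ x i) ∧ ∀ i ∈ n, x i ≤ 0}

theorem region_empty : 𝒱.region ∅ ∅ = 𝒱.affineSpace := by
  simp [region]

theorem region_anti {p p' n n' : Finset I} (hp : p ⊆ p') (hn : n ⊆ n') :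
    𝒱.region p' n' ⊆ 𝒱.region p n :=
  fun _ hx => ⟨hx.1, fun i hi => hx.2.1 i (hp hi), fun i hi => hx.2.2 i (hn hi)⟩

/-- A convex combination of a nonnegative and a nonpositive number vanishes. -/
theorem exists_convex_combination_eq_zero {s t : ℝ} (hs : 0 ≤ s) (ht : t ≤ 0) :
    ∃ a b : ℝ, 0 ≤ a ∧ 0 ≤ b ∧ a + b = 1 ∧ a * s + b * t = 0 := by
  rcases hs.eq_or_lt with rfl | hs
  · exact ⟨1, 0, zero_le_one, le_rfl, by norm_num, by norm_num⟩
  · have h : s - t ≠ 0 := by linarith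
    refine ⟨-t / (s - t), s / (s - t), div_nonneg (by linarith) (by linarith),
      div_nonneg hs.le (by linarith), ?_, ?_⟩
    · field_simp
      ring
    · field_simp
      ring

theorem combination_mem_affineSpace {x z : I → ℝ} (hx : x ∈ 𝒱.affineSpace)
    (hz : z ∈ 𝒱.affineSpace) {a b : ℝ} (hab : a + b = 1) :
    a • x + b • z ∈ 𝒱.affineSpace := by
  change 𝒱.V.mkQ _ = 𝒱.η
  rw [map_add, map_smul, map_smul, show 𝒱.V.mkQ x = 𝒱.η from hx,
    show 𝒱.V.mkQ z = 𝒱.η from hz, ← add_smul, hab, one_smul]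

section

variable [DecidableEq I]

theorem flat_union_inter_region (S Z p n : Finset I) :
    𝒱.flat (S ∪ Z) ∩ 𝒱.region p n = 𝒱.flat S ∩ 𝒱.region (p ∪ Z) (n ∪ Z) := by
  ext x
  constructor
  · rintro ⟨⟨hx, hSZ⟩, -, hp, hn⟩
    have hZ : ∀ i ∈ Z, x i = 0 := fun i hi => hSZ i (Finset.mem_union_right _ hi)
    refine ⟨⟨hx, fun i hi => hSZ i (Finset.mem_union_left _ hi)⟩, hx, fun i hi => ?_,
      fun i hi => ?_⟩
    · exact (Finset.mem_union.1 hi).elim (hp i) fun h => (hZ i h).ge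
    · exact (Finset.mem_union.1 hi).elim (hn i) fun h => (hZ i h).le
  · rintro ⟨⟨hx, hS⟩, -, hp, hn⟩
    refine ⟨⟨hx, fun i hi => ?_⟩, hx, fun i hi => hp i (Finset.mem_union_left _ hi),
      fun i hi => hn i (Finset.mem_union_left _ hi)⟩
    rcases Finset.mem_union.1 hi with h | h
    · exact hS i h
    · exact le_antisymm (hn i (Finset.mem_union_right _ h)) (hp i (Finset.mem_union_right _ h))

theorem faceIdeal_region_union (p n Z : Finset I) :
    𝒱.faceIdeal (𝒱.region (p ∪ Z) (n ∪ Z)) =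
      monomialIdeal fun S => (𝒱.flat (S ∪ Z) ∩ 𝒱.region p n).Nonempty := by
  simp only [faceIdeal_eq_monomialIdeal, flat_union_inter_region]

theorem faceIdeal_region_eq_inf (p n : Finset I) (i : I) :
    𝒱.faceIdeal (𝒱.region p n) =
      𝒱.faceIdeal (𝒱.region (insert i p) n) ⊓ 𝒱.faceIdeal (𝒱.region p (insert i n)) := by
  apply le_antisymm
  · exact le_inf (𝒱.faceIdeal_anti (region_anti (Finset.subset_insert _ _) subset_rfl))
      (𝒱.faceIdeal_anti (region_anti subset_rfl (Finset.subset_insert _ _)))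
  · intro x hx
    obtain ⟨h₁, h₂⟩ := Submodule.mem_inf.1 hx
    rw [faceIdeal_eq_monomialIdeal, mem_monomialIdeal (isComplex_flat_inter _)] at h₁ h₂ ⊢
    rintro s hs ⟨z, hzs, hz, hp, hn⟩
    rcases le_total 0 (z i) with h | h
    · exact h₁ s hs ⟨z, hzs, hz, by simpa [h] using hp, hn⟩
    · exact h₂ s hs ⟨z, hzs, hz, hp, by simpa [h] using hn⟩

/-- A flat that meets a convex region on both sides of a hyperplane meets it on the
hyperplane. -/
theorem faceIdeal_region_eq_sup (p n : Finset I) (i : I) :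
    𝒱.faceIdeal (𝒱.region (insert i p) (insert i n)) =
      𝒱.faceIdeal (𝒱.region (insert i p) n) ⊔ 𝒱.faceIdeal (𝒱.region p (insert i n)) := by
  apply le_antisymm
  · refine Ideal.span_le.2 ?_
    rintro _ ⟨S, hS, rfl⟩
    by_cases h₁ : 𝒱.flat S ∩ 𝒱.region (insert i p) n = ∅
    · exact Ideal.mem_sup_left (Ideal.subset_span ⟨S, h₁, rfl⟩)
    by_cases h₂ : 𝒱.flat S ∩ 𝒱.region p (insert i n) = ∅
    · exact Ideal.mem_sup_right (Ideal.subset_span ⟨S, h₂, rfl⟩)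
    exfalso
    obtain ⟨x, hxS, hx, hxp, hxn⟩ := Set.nonempty_iff_ne_empty.2 h₁
    obtain ⟨z, hzS, hz, hzp, hzn⟩ := Set.nonempty_iff_ne_empty.2 h₂
    obtain ⟨a, b, ha, hb, hab, h0⟩ := exists_convex_combination_eq_zero
      (hxp i (Finset.mem_insert_self _ _)) (hzn i (Finset.mem_insert_self _ _))
    have hmem := combination_mem_affineSpace hx hz hab
    refine Set.eq_empty_iff_forall_notMem.1 hS (a • x + b • z)
      ⟨⟨hmem, fun j hj => ?_⟩, hmem, fun j hj => ?_, fun j hj => ?_⟩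
    · simp [hxS.2 j hj, hzS.2 j hj]
    · rcases Finset.mem_insert.1 hj with rfl | hj
      · exact h0.ge
      · exact add_nonneg (mul_nonneg ha (hxp j (Finset.mem_insert_of_mem hj)))
          (mul_nonneg hb (hzp j hj))
    · rcases Finset.mem_insert.1 hj with rfl | hj
      · exact h0.le
      · exact add_nonpos (mul_nonpos_of_nonneg_of_nonpos ha (hxn j hj))
          (mul_nonpos_of_nonneg_of_nonpos hb (hzn j (Finset.mem_insert_of_mem hj)))
  · exact sup_le (𝒱.faceIdeal_anti (region_anti subset_rfl (Finset.subset_insert _ _)))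
      (𝒱.faceIdeal_anti (region_anti (Finset.subset_insert _ _) subset_rfl))

/-- The sign vector that is `1` on `p` and `-1` elsewhere. -/
def signOf (p : Finset I) (i : I) : ℤˣ := if i ∈ p then 1 else -1

omit [Fintype I] in
theorem signOf_mul_nonneg {p n : Finset I} (hpn : ∀ i, i ∈ p ∨ i ∈ n) {x : I → ℝ}
    (hp : ∀ i ∈ p, 0 ≤ x i) (hn : ∀ i ∈ n, x i ≤ 0) (i : I) :
    0 ≤ ((signOf p i : ℤ) : ℝ) * x i := by
  by_cases h : i ∈ p
  · simpa [signOf, h] using hp i h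
  · simpa [signOf, h] using hn i ((hpn i).resolve_left h)

theorem region_eq_chamber {p n : Finset I} (hpn : ∀ i, i ∈ p ∨ i ∈ n) (hd : p ∩ n = ∅) :
    𝒱.region p n = 𝒱.chamber (signOf p) := by
  ext x
  refine ⟨fun hx => ⟨hx.1, signOf_mul_nonneg hpn hx.2.1 hx.2.2⟩,
    fun hx => ⟨hx.1, fun i hi => ?_, fun i hi => ?_⟩⟩
  · simpa [signOf, hi] using hx.2 i
  · have hip : i ∉ p := fun hip => by
      have : i ∈ p ∩ n := Finset.mem_inter.2 ⟨hip, hi⟩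
      simp [hd] at this
    simpa [signOf, hip] using hx.2 i

theorem shellable_region {p n : Finset I} (hpn : ∀ i, i ∈ p ∨ i ∈ n) :
    Shellable (𝒱.ShellingCond (signOf p)) fun S => (𝒱.flat S ∩ 𝒱.region p n).Nonempty := by
  have h₁ : 𝒱.region p (n \ p) = 𝒱.chamber (signOf p) :=
    region_eq_chamber (fun i => by have := hpn i; simp; tauto) (by simp)
  have h₂ : p ∪ p ∩ n = p := by simp
  have h₃ : n \ p ∪ p ∩ n = n := by
    rw [Finset.inter_comm]
    exact Finset.sdiff_union_inter n p
  have := (shellable_chamber (𝒱 := 𝒱) (signOf p)).link (fun _ _ _ hG h => h.mono hG) (p ∩ n)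
  simpa only [← h₁, flat_union_inter_region, h₂, h₃] using this

/-- A basis of `V` is a regular sequence on the face ring of every region. -/
theorem regularMod_region (p n : Finset I) :
    RegularMod 𝒱.basisForm 𝒱.dim (𝒱.faceIdeal (𝒱.region p n)) := by
  induction hN : ((p ∪ n)ᶜ).card using Nat.strong_induction_on generalizing p n with
  | _ N ih =>
    subst hN
    by_cases hpn : ∀ i, i ∈ p ∨ i ∈ n
    · rw [faceIdeal_eq_monomialIdeal]
      exact (shellable_region hpn).regularMod fun b G h => h.1.regularMod
    · push Not at hpn
      obtain ⟨i, hip, hin⟩ := hpn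
      have hi : i ∈ (p ∪ n)ᶜ := by simp [hip, hin]
      have hlt : ∀ q : Finset I, q = insert i (p ∪ n) → qᶜ.card < ((p ∪ n)ᶜ).card := by
        rintro _ rfl
        rw [Finset.compl_insert]
        exact Finset.card_erase_lt_of_mem hi
      rw [faceIdeal_region_eq_inf p n i]
      refine (ih _ (hlt _ ?_) _ _ rfl).inf (ih _ (hlt _ ?_) _ _ rfl) ?_
      · rw [Finset.insert_union]
      · rw [Finset.union_insert]
      · rw [← faceIdeal_region_eq_sup]
        refine ih _ (hlt _ ?_) _ _ rfl
        rw [Finset.insert_union, Finset.union_insert, Finset.insert_idem]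

end

/-! ### Bounded and unbounded faces -/

theorem exists_mem_cone_of_notMem_bounded {α : I → ℤˣ} (h : α ∉ 𝒱.bounded) :
    ∃ y ∈ 𝒱.cone α, 0 < 𝒱.ξ y := by
  by_contra! hle
  refine h ⟨0, ?_⟩
  rintro _ ⟨y, hy, rfl⟩
  exact hle y hy

theorem notMem_cone_of_mem_bounded {α : I → ℤˣ} (h : α ∈ 𝒱.bounded) {y : 𝒱.V}
    (hy : 0 < 𝒱.ξ y) : y ∉ 𝒱.cone α := by
  intro hmem
  obtain ⟨M, hM⟩ := h
  obtain ⟨N, hN⟩ := exists_nat_gt (M / 𝒱.ξ y)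
  have := hM ⟨(N : ℝ) • y, fun i => ?_, rfl⟩
  · rw [map_smul, smul_eq_mul] at this
    rw [div_lt_iff₀ hy] at hN
    linarith
  · rw [Submodule.coe_smul, Pi.smul_apply, smul_eq_mul, mul_left_comm]
    exact mul_nonneg (Nat.cast_nonneg N) (hmem i)

variable [DecidableEq I]

/-- A face that does not lie in a bounded feasible chamber recedes in a direction in which `ξ`
increases. -/
theorem exists_direction {p n : Finset I} (hpn : ∀ i, i ∈ p ∨ i ∈ n)
    (hne : (𝒱.region p n).Nonempty) (h : ∀ β : 𝒱.P, ¬ 𝒱.region p n ⊆ 𝒱.Δ β) :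
    ∃ y : 𝒱.V, (∀ i ∈ p, 0 ≤ (y : I → ℝ) i) ∧ (∀ i ∈ n, (y : I → ℝ) i ≤ 0) ∧ 0 < 𝒱.ξ y := by
  induction hN : (p ∩ n).card generalizing p n with
  | zero =>
    rw [Finset.card_eq_zero] at hN
    have hreg := region_eq_chamber (𝒱 := 𝒱) hpn hN
    have hb : signOf p ∉ 𝒱.bounded := fun hb =>
      h ⟨signOf p, by rw [hreg] at hne; exact hne, hb⟩ hreg.subset
    obtain ⟨y, hy, hpos⟩ := exists_mem_cone_of_notMem_bounded hb
    refine ⟨y, fun i hi => ?_, fun i hi => ?_, hpos⟩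
    · simpa [signOf, hi] using hy i
    · have hip : i ∉ p := fun hip => by
        have : i ∈ p ∩ n := Finset.mem_inter.2 ⟨hip, hi⟩
        simp [hN] at this
      simpa [signOf, hip] using hy i
  | succ N ih =>
    obtain ⟨i, hi⟩ : (p ∩ n).Nonempty := by
      rw [← Finset.card_pos]
      omega
    have hip := (Finset.mem_inter.1 hi).1
    have hin := (Finset.mem_inter.1 hi).2
    have hcard : ((p ∩ n).erase i).card = N := by
      rw [Finset.card_erase_of_mem hi, hN, Nat.add_sub_cancel]
    -- the two faces of one dimension more on either side of `H_i` also recede, and a convex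
    -- combination of their directions is parallel to `H_i`
    have hsub₁ : 𝒱.region p n ⊆ 𝒱.region p (n.erase i) :=
      region_anti subset_rfl (Finset.erase_subset _ _)
    have hsub₂ : 𝒱.region p n ⊆ 𝒱.region (p.erase i) n :=
      region_anti (Finset.erase_subset _ _) subset_rfl
    obtain ⟨y, hyp, hyn, hy⟩ := ih (p := p) (n := n.erase i)
      (fun j => by
        rcases eq_or_ne j i with rfl | hj
        · exact Or.inl hip
        · simpa [hj] using hpn j)
      (hne.mono hsub₁) (fun β hβ => h β (hsub₁.trans hβ)) (by rwa [Finset.inter_erase])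
    obtain ⟨z, hzp, hzn, hz⟩ := ih (p := p.erase i) (n := n)
      (fun j => by
        rcases eq_or_ne j i with rfl | hj
        · exact Or.inr hin
        · simpa [hj] using hpn j)
      (hne.mono hsub₂) (fun β hβ => h β (hsub₂.trans hβ)) (by rwa [Finset.erase_inter])
    obtain ⟨a, b, ha, hb, hab, h0⟩ := exists_convex_combination_eq_zero (hyp i hip) (hzn i hin)
    refine ⟨a • y + b • z, fun j hj => ?_, fun j hj => ?_, ?_⟩
    · rcases eq_or_ne j i with rfl | hji
      · exact h0.ge
      · exact add_nonneg (mul_nonneg ha (hyp j hj))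
          (mul_nonneg hb (hzp j (Finset.mem_erase.2 ⟨hji, hj⟩)))
    · rcases eq_or_ne j i with rfl | hji
      · exact h0.le
      · exact add_nonpos
          (mul_nonpos_of_nonneg_of_nonpos ha (hyn j (Finset.mem_erase.2 ⟨hji, hj⟩)))
          (mul_nonpos_of_nonneg_of_nonpos hb (hzn j hj))
    · rw [map_add, map_smul, map_smul, smul_eq_mul, smul_eq_mul]
      rcases ha.eq_or_lt with rfl | ha
      · rw [zero_add] at hab
        simp [hab, hz]
      · exact add_pos_of_pos_of_nonneg (mul_pos ha hy) (mul_nonneg hb hz.le)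

/-- A bounded chamber meets a face that recedes along `y` only inside hyperplanes transverse to
`y`. -/
theorem exists_region_inter_subset {p n : Finset I} (hpn : ∀ i, i ∈ p ∨ i ∈ n) {y : 𝒱.V}
    (hp : ∀ i ∈ p, 0 ≤ (y : I → ℝ) i) (hn : ∀ i ∈ n, (y : I → ℝ) i ≤ 0) (hy : 0 < 𝒱.ξ y)
    (β : 𝒱.P) :
    ∃ i, (y : I → ℝ) i ≠ 0 ∧ 𝒱.region p n ∩ 𝒱.Δ β ⊆ 𝒱.region (p ∪ {i}) (n ∪ {i}) := by
  have := notMem_cone_of_mem_bounded β.2.2 hy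
  simp only [cone, Set.mem_ofPred_eq, not_forall, not_le] at this
  obtain ⟨i, hi⟩ := this
  have hyi : (y : I → ℝ) i ≠ 0 := fun h => by simp [h] at hi
  refine ⟨i, hyi, ?_⟩
  rintro x ⟨⟨hx, hxp, hxn⟩, hβ⟩
  have h1 : 0 ≤ x i * (y : I → ℝ) i := by
    rcases hpn i with h | h
    · exact mul_nonneg (hxp i h) (hp i h)
    · exact mul_nonneg_of_nonpos_of_nonpos (hxn i h) (hn i h)
  have h2 : x i = 0 := by
    have h3 := mul_nonpos_of_nonneg_of_nonpos (hβ.2 i) hi.le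
    have h4 := sign_mul_self β.1 i
    have h5 : x i * (y : I → ℝ) i = 0 := by
      refine le_antisymm ?_ h1
      calc x i * (y : I → ℝ) i = ((β.1 i : ℤ) : ℝ) * x i * (((β.1 i : ℤ) : ℝ) * (y : I → ℝ) i) := by
            linear_combination (-(x i * (y : I → ℝ) i)) * h4
        _ ≤ 0 := h3
    exact (mul_eq_zero.1 h5).resolve_right hyi
  refine ⟨hx, fun j hj => ?_, fun j hj => ?_⟩
  · rcases Finset.mem_union.1 hj with hj | hj
    · exact hxp j hj
    · rw [Finset.mem_singleton.1 hj, h2]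
  · rcases Finset.mem_union.1 hj with hj | hj
    · exact hxn j hj
    · rw [Finset.mem_singleton.1 hj, h2]

end Regions

/-! ### Gluing along bounded feasible chambers -/

section Gluing

variable {I : Type*} [Fintype I] {𝒱 : PolarizedArrangement I}

variable (𝒱) in
/-- The sheaf condition for the face ring of `D` modulo `K` and the covering of `D` by the
chambers in `𝒫`: elements are determined by their restrictions, and compatible families glue. -/
structure Glues (K : Ideal (MvPolynomial I ℝ)) (D : Set (I → ℝ)) : Prop where
  sep : ∀ x, (∀ β, x ∈ 𝒱.faceIdeal (D ∩ 𝒱.Δ β) ⊔ K) → x ∈ 𝒱.faceIdeal D ⊔ K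
  glue : ∀ p : 𝒱.P → MvPolynomial I ℝ,
    (∀ β γ, p β - p γ ∈ 𝒱.faceIdeal (D ∩ (𝒱.Δ β ∩ 𝒱.Δ γ)) ⊔ K) →
      ∃ x, ∀ β, x - p β ∈ 𝒱.faceIdeal (D ∩ 𝒱.Δ β) ⊔ K

theorem mem_faceIdeal_sup_of_subset {K : Ideal (MvPolynomial I ℝ)} {D E : Set (I → ℝ)}
    (h : D ⊆ E) {x : MvPolynomial I ℝ} (hx : x ∈ 𝒱.faceIdeal E ⊔ K) : x ∈ 𝒱.faceIdeal D ⊔ K :=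
  Ideal.mem_sup_of_le_left (𝒱.faceIdeal_anti h) hx

theorem Glues.of_subset {K : Ideal (MvPolynomial I ℝ)} {D : Set (I → ℝ)} {β : 𝒱.P}
    (h : D ⊆ 𝒱.Δ β) : 𝒱.Glues K D where
  sep x hx := by simpa [Set.inter_eq_left.2 h] using hx β
  glue p hp := ⟨p β, fun γ => by
    have := hp β γ
    rwa [← Set.inter_assoc, Set.inter_eq_left.2 h] at this⟩

theorem Glues.of_not_nonempty {K : Ideal (MvPolynomial I ℝ)} {D : Set (I → ℝ)}
    (h : ¬ D.Nonempty) : 𝒱.Glues K D where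
  sep x _ := by simp [faceIdeal_eq_top h]
  glue p _ := ⟨0, fun β => by
    rw [faceIdeal_eq_top fun h' => h (h'.mono Set.inter_subset_left)]
    simp⟩

variable [DecidableEq I]

/-- The sheaf condition passes from the two sides of a hyperplane and the hyperplane section to
the whole region. -/
theorem Glues.of_halves {k : ℕ} (hk : k ≤ 𝒱.dim) {p n : Finset I} (i : I)
    (h₁ : 𝒱.Glues (initialIdeal 𝒱.basisForm k) (𝒱.region (insert i p) n))
    (h₂ : 𝒱.Glues (initialIdeal 𝒱.basisForm k) (𝒱.region p (insert i n)))
    (h₀ : 𝒱.Glues (initialIdeal 𝒱.basisForm k) (𝒱.region (insert i p) (insert i n))) :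
    𝒱.Glues (initialIdeal 𝒱.basisForm k) (𝒱.region p n) := by
  have hs₁ : 𝒱.region (insert i p) n ⊆ 𝒱.region p n :=
    region_anti (Finset.subset_insert _ _) subset_rfl
  have hs₂ : 𝒱.region p (insert i n) ⊆ 𝒱.region p n :=
    region_anti subset_rfl (Finset.subset_insert _ _)
  have hs₀₁ : 𝒱.region (insert i p) (insert i n) ⊆ 𝒱.region (insert i p) n :=
    region_anti subset_rfl (Finset.subset_insert _ _)
  have hs₀₂ : 𝒱.region (insert i p) (insert i n) ⊆ 𝒱.region p (insert i n) :=
    region_anti (Finset.subset_insert _ _) subset_rfl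
  refine ⟨fun x hx => ?_, fun q hq => ?_⟩
  · have hreg := regularMod_region (𝒱 := 𝒱) (insert i p) (insert i n)
    rw [faceIdeal_region_eq_sup] at hreg
    rw [faceIdeal_region_eq_inf p n i]
    exact hreg.inf_sup_initialIdeal_le hk (Submodule.mem_inf.2
      ⟨h₁.sep x fun β => mem_faceIdeal_sup_of_subset (Set.inter_subset_inter_left _ hs₁) (hx β),
        h₂.sep x fun β => mem_faceIdeal_sup_of_subset (Set.inter_subset_inter_left _ hs₂) (hx β)⟩)
  · obtain ⟨x, hx⟩ := h₁.glue q fun β γ =>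
      mem_faceIdeal_sup_of_subset (Set.inter_subset_inter_left _ hs₁) (hq β γ)
    obtain ⟨z, hz⟩ := h₂.glue q fun β γ =>
      mem_faceIdeal_sup_of_subset (Set.inter_subset_inter_left _ hs₂) (hq β γ)
    have hxz := h₀.sep (x - z) fun β => by
      convert sub_mem
        (mem_faceIdeal_sup_of_subset (Set.inter_subset_inter_left _ hs₀₁) (hx β))
        (mem_faceIdeal_sup_of_subset (Set.inter_subset_inter_left _ hs₀₂) (hz β)) using 1
      ring
    rw [faceIdeal_region_eq_sup, sup_sup_distrib_right] at hxz
    obtain ⟨a, ha, b, hb, hab⟩ := Submodule.mem_sup.1 hxz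
    refine ⟨x - a, fun β => ?_⟩
    -- a chamber lies on one side of `H_i`
    rcases Int.units_eq_one_or (β.1 i) with h | h
    · have hsub : 𝒱.region p n ∩ 𝒱.Δ β ⊆ 𝒱.region (insert i p) n ∩ 𝒱.Δ β := by
        rintro y ⟨⟨hy, hp, hn⟩, hβ⟩
        refine ⟨⟨hy, fun j hj => ?_, hn⟩, hβ⟩
        rcases Finset.mem_insert.1 hj with rfl | hj
        · simpa [h] using hβ.2 j
        · exact hp j hj
      refine mem_faceIdeal_sup_of_subset hsub ?_
      convert sub_mem (hx β) (mem_faceIdeal_sup_of_subset Set.inter_subset_left ha) using 1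
      ring
    · have hsub : 𝒱.region p n ∩ 𝒱.Δ β ⊆ 𝒱.region p (insert i n) ∩ 𝒱.Δ β := by
        rintro y ⟨⟨hy, hp, hn⟩, hβ⟩
        refine ⟨⟨hy, hp, fun j hj => ?_⟩, hβ⟩
        rcases Finset.mem_insert.1 hj with rfl | hj
        · simpa [h] using hβ.2 j
        · exact hn j hj
      refine mem_faceIdeal_sup_of_subset hsub ?_
      have hxa : x - a - q β = (z - q β) + b := by linear_combination -hab
      rw [hxa]
      exact add_mem (hz β) (mem_faceIdeal_sup_of_subset Set.inter_subset_left hb)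

/-- The sheaf condition for an unbounded face follows from that for its facets transverse to a
direction in which it recedes, and for the intersections of these facets. -/
theorem Glues.of_direction {k : ℕ} (hk : k ≤ 𝒱.dim) {p n : Finset I}
    (hpn : ∀ i, i ∈ p ∨ i ∈ n) {y : 𝒱.V} (hp : ∀ i ∈ p, 0 ≤ (y : I → ℝ) i)
    (hn : ∀ i ∈ n, (y : I → ℝ) i ≤ 0) (hy : 0 < 𝒱.ξ y)
    (h : ∀ Z : Finset I, (∃ i ∈ Z, (y : I → ℝ) i ≠ 0) →
      𝒱.Glues (initialIdeal 𝒱.basisForm k) (𝒱.region (p ∪ Z) (n ∪ Z))) :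
    𝒱.Glues (initialIdeal 𝒱.basisForm k) (𝒱.region p n) := by
  have hsub : ∀ Z, 𝒱.region (p ∪ Z) (n ∪ Z) ⊆ 𝒱.region p n := fun Z =>
    region_anti Finset.subset_union_left Finset.subset_union_left
  let T : Set I := {i | (y : I → ℝ) i ≠ 0}
  have hZ : ∀ i ∈ T, 𝒱.Glues (initialIdeal 𝒱.basisForm k) (𝒱.region (p ∪ {i}) (n ∪ {i})) :=
    fun i hi => h {i} ⟨i, Finset.mem_singleton_self i, hi⟩
  have hθ : ∀ b G, 𝒱.ShellingCond (signOf p) b G →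
      RegularMod 𝒱.basisForm 𝒱.dim (Ideal.span (MvPolynomial.X '' {i | i ∉ b})) :=
    fun b G h => h.1.regularMod
  have hT : ∀ b G, 𝒱.ShellingCond (signOf p) b G → ∃ i ∈ T, i ∈ b ∧ i ∉ G := by
    intro b G hbG
    refine hbG.2 y y.2 (fun h0 => ?_) (signOf_mul_nonneg hpn hp hn)
    rw [Submodule.coe_eq_zero] at h0
    simp [h0] at hy
  refine ⟨fun x hx => ?_, fun q hq => ?_⟩
  · rw [faceIdeal_eq_monomialIdeal]
    refine (shellable_region hpn).mem_of_forall_mem_star hθ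
      (fun _ _ _ hG h => h.mono hG) hT hk fun i hi => ?_
    rw [← faceIdeal_region_union]
    exact (hZ i hi).sep x fun β =>
      mem_faceIdeal_sup_of_subset (Set.inter_subset_inter_left _ (hsub _)) (hx β)
  · have hex : ∀ i, ∃ x, i ∈ T → ∀ β, x - q β ∈
        𝒱.faceIdeal (𝒱.region (p ∪ {i}) (n ∪ {i}) ∩ 𝒱.Δ β) ⊔ initialIdeal 𝒱.basisForm k := by
      intro i
      by_cases hi : i ∈ T
      · obtain ⟨x, hx⟩ := (hZ i hi).glue q fun β γ =>
          mem_faceIdeal_sup_of_subset (Set.inter_subset_inter_left _ (hsub _)) (hq β γ)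
        exact ⟨x, fun _ => hx⟩
      · exact ⟨0, fun h => absurd h hi⟩
    choose x hx using hex
    have hs : ∀ {Z Z' : Finset I}, Z ⊆ Z' →
        𝒱.region (p ∪ Z') (n ∪ Z') ⊆ 𝒱.region (p ∪ Z) (n ∪ Z) := fun hZZ' =>
      region_anti (Finset.union_subset_union_right hZZ') (Finset.union_subset_union_right hZZ')
    obtain ⟨z, hz⟩ := (shellable_region hpn).exists_forall_sub_mem_star hθ
      (fun _ _ _ hG h => h.mono hG) hT hk x fun i hi j hj => by
        rw [← faceIdeal_region_union]
        refine (h {i, j} ⟨i, by simp, hi⟩).sep _ fun β => ?_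
        have hs' : ∀ l ∈ ({i, j} : Finset I), 𝒱.region (p ∪ {i, j}) (n ∪ {i, j}) ∩ 𝒱.Δ β ⊆
            𝒱.region (p ∪ {l}) (n ∪ {l}) ∩ 𝒱.Δ β := fun l hl =>
          Set.inter_subset_inter_left _ (hs (Finset.singleton_subset_iff.2 hl))
        convert sub_mem (mem_faceIdeal_sup_of_subset (hs' i (by simp)) (hx i hi β))
          (mem_faceIdeal_sup_of_subset (hs' j (by simp)) (hx j hj β)) using 1
        ring
    refine ⟨z, fun β => ?_⟩
    obtain ⟨i, hi, hβ⟩ := exists_region_inter_subset hpn hp hn hy β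
    have h1 := hz i hi
    rw [← faceIdeal_region_union] at h1
    convert add_mem (mem_faceIdeal_sup_of_subset hβ h1)
      (mem_faceIdeal_sup_of_subset (Set.subset_inter hβ Set.inter_subset_right) (hx i hi β)) using 1
    ring

/-- Every region satisfies the sheaf condition for the chambers in `𝒫`, also modulo the first `k`
members of the basis of `V`. -/
theorem glues_region {k : ℕ} (hk : k ≤ 𝒱.dim) (p n : Finset I) :
    𝒱.Glues (initialIdeal 𝒱.basisForm k) (𝒱.region p n) := by
  -- every step imposes a further sign condition
  induction hN : pᶜ.card + nᶜ.card using Nat.strong_induction_on generalizing p n with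
  | _ N ih =>
    subst hN
    have hlt : ∀ {q q' : Finset I} {i : I}, q ⊆ q' → i ∈ q' → i ∉ q → q'ᶜ.card < qᶜ.card :=
      fun h h₁ h₂ => Finset.card_lt_card (Finset.compl_ssubset_compl.2
        ((Finset.ssubset_iff_of_subset h).2 ⟨_, h₁, h₂⟩))
    have hle : ∀ {q q' : Finset I}, q ⊆ q' → q'ᶜ.card ≤ qᶜ.card :=
      fun h => Finset.card_le_card (Finset.compl_subset_compl.2 h)
    by_cases hpn : ∀ i, i ∈ p ∨ i ∈ n
    · by_cases hβ : ∃ β : 𝒱.P, 𝒱.region p n ⊆ 𝒱.Δ β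
      · obtain ⟨β, hβ⟩ := hβ
        exact .of_subset hβ
      by_cases hne : (𝒱.region p n).Nonempty
      · obtain ⟨y, hp, hn, hy⟩ := exists_direction hpn hne (not_exists.1 hβ)
        refine .of_direction hk hpn hp hn hy fun Z ⟨i, hiZ, hi⟩ => ih _ ?_ _ _ rfl
        have hipn : i ∉ p ∨ i ∉ n := by
          by_contra! h
          exact hi (le_antisymm (hn i h.2) (hp i h.1))
        rcases hipn with h | h
        · exact add_lt_add_of_lt_of_le
            (hlt Finset.subset_union_left (Finset.mem_union_right _ hiZ) h)
            (hle Finset.subset_union_left)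
        · exact add_lt_add_of_le_of_lt (hle Finset.subset_union_left)
            (hlt Finset.subset_union_left (Finset.mem_union_right _ hiZ) h)
      · exact .of_not_nonempty hne
    · push Not at hpn
      obtain ⟨i, hip, hin⟩ := hpn
      have hp := hlt (Finset.subset_insert i p) (Finset.mem_insert_self i p) hip
      have hn := hlt (Finset.subset_insert i n) (Finset.mem_insert_self i n) hin
      exact .of_halves hk i (ih _ (by omega) _ _ rfl) (ih _ (by omega) _ _ rfl)
        (ih _ (by omega) _ _ rfl)

omit [DecidableEq I] in
theorem glues_affineSpace {k : ℕ} (hk : k ≤ 𝒱.dim) :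
    𝒱.Glues (initialIdeal 𝒱.basisForm k) 𝒱.affineSpace := by
  classical
  rw [← region_empty]
  exact glues_region hk ∅ ∅

end Gluing

/-! ### The center -/

section Center

variable {I : Type*} [Fintype I] {𝒱 : PolarizedArrangement I}

namespace ConvAlg

variable {K : Ideal (MvPolynomial I ℝ)}

/-- The element of `⨁ R_{αβ}` whose only nonzero component is the unit of `R_{αβ}`. -/
noncomputable def unit (K : Ideal (MvPolynomial I ℝ)) (α β : 𝒱.P) : 𝒱.ConvAlg K :=
  fun γ δ => if γ = α ∧ δ = β then 1 else 0

theorem mul_unit_apply (z : 𝒱.ConvAlg K) (α β γ : 𝒱.P) :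
    (z * unit K α β : 𝒱.ConvAlg K) γ β = 𝒱.star K γ α β (z γ α) 1 := by
  rw [mul_apply, Finset.sum_eq_single α]
  · rw [unit, if_pos ⟨rfl, rfl⟩]
  · intro δ _ h
    rw [unit, if_neg fun h' => h h'.1, star_zero]
  · simp

theorem unit_mul_apply (z : 𝒱.ConvAlg K) (α β γ : 𝒱.P) :
    (unit K α β * z : 𝒱.ConvAlg K) α γ = 𝒱.star K α β γ 1 (z β γ) := by
  rw [mul_apply, Finset.sum_eq_single β]
  · rw [unit, if_pos ⟨rfl, rfl⟩]
  · intro δ _ h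
    rw [unit, if_neg fun h' => h h'.2, zero_star]
  · simp

theorem unit_mul_apply_of_ne (z : 𝒱.ConvAlg K) {α γ : 𝒱.P} (β δ : 𝒱.P) (h : γ ≠ α) :
    (unit K α β * z : 𝒱.ConvAlg K) γ δ = 0 := by
  rw [mul_apply]
  refine Finset.sum_eq_zero fun ε _ => ?_
  rw [unit, if_neg fun h' => h h'.1, zero_star]

theorem diag_mem_center (p : MvPolynomial I ℝ) :
    diag (𝒱 := 𝒱) K p ∈ Subalgebra.center ℝ (𝒱.ConvAlg K) := by
  rw [Subalgebra.mem_center_iff]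
  intro z
  ext α β
  rw [mul_diag_apply, diag_mul_apply, mul_comm]

/-- A central element is diagonal, by commutation with the idempotents `1 ∈ R_{αα}`, and its
diagonal components agree on intersections of chambers, by commutation with `1 ∈ R_{αβ}`. -/
theorem exists_of_mem_center {z : 𝒱.ConvAlg K} (hz : z ∈ Subalgebra.center ℝ (𝒱.ConvAlg K)) :
    ∃ p : 𝒱.P → MvPolynomial I ℝ, (∀ α, z α α = Ideal.Quotient.mk _ (p α)) ∧
      (∀ α β, α ≠ β → z α β = 0) ∧
      ∀ α β, p α - p β ∈ 𝒱.faceIdeal (𝒱.Δ α ∩ 𝒱.Δ β) ⊔ K := by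
  rw [Subalgebra.mem_center_iff] at hz
  have hsurj : ∀ α, ∃ p, Ideal.Quotient.mk (𝒱.faceIdeal (𝒱.Δ α ∩ 𝒱.Δ α) ⊔ K) p = z α α :=
    fun α => Ideal.Quotient.mk_surjective _
  choose p hp using hsurj
  refine ⟨p, fun α => (hp α).symm, fun α β hαβ => ?_, fun α β => ?_⟩
  · have h := congrArg (fun w : 𝒱.ConvAlg K => w α β) (hz (unit K β β))
    simp only [mul_unit_apply, unit_mul_apply_of_ne _ _ _ hαβ] at h
    rw [← map_one (Ideal.Quotient.mk (𝒱.faceIdeal (𝒱.Δ β ∩ 𝒱.Δ β) ⊔ K)), star_mk_right,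
      map_one, mul_one] at h
    exact h.symm
  · have h := congrArg (fun w : 𝒱.ConvAlg K => w α β) (hz (unit K α β))
    simp only [mul_unit_apply, unit_mul_apply] at h
    rw [← hp α, ← hp β, star_mk_right, mk_star, mul_one, one_mul] at h
    exact Ideal.Quotient.eq.1 h.symm

theorem mem_center_iff_exists_diag (h : 𝒱.Glues K 𝒱.affineSpace) (z : 𝒱.ConvAlg K) :
    z ∈ Subalgebra.center ℝ (𝒱.ConvAlg K) ↔ ∃ p, diag K p = z := by
  refine ⟨fun hz => ?_, ?_⟩
  · obtain ⟨p, hp, h0, hcompat⟩ := exists_of_mem_center hz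
    obtain ⟨x, hx⟩ := h.glue p fun β γ =>
      mem_faceIdeal_sup_of_subset Set.inter_subset_right (hcompat β γ)
    refine ⟨x, ?_⟩
    ext α β
    rw [diag_apply]
    split_ifs with hαβ
    · subst hαβ
      rw [hp]
      have hsub : 𝒱.Δ α ∩ 𝒱.Δ α ⊆ 𝒱.affineSpace ∩ 𝒱.Δ α := fun y hy => ⟨hy.1.1, hy.1⟩
      exact Ideal.Quotient.eq.2 (mem_faceIdeal_sup_of_subset hsub (hx α))
    · exact (h0 α β hαβ).symm
  · rintro ⟨p, rfl⟩
    exact diag_mem_center p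

theorem diag_eq_zero_iff (h : 𝒱.Glues K 𝒱.affineSpace) (p : MvPolynomial I ℝ) :
    diag (𝒱 := 𝒱) K p = 0 ↔ p ∈ 𝒱.faceIdeal 𝒱.affineSpace ⊔ K := by
  constructor
  · intro hp
    refine h.sep p fun β => ?_
    have := congrArg (fun w : 𝒱.ConvAlg K => w β β) hp
    simp only [diag_apply, if_true, zero_apply] at this
    have hsub : 𝒱.affineSpace ∩ 𝒱.Δ β ⊆ 𝒱.Δ β ∩ 𝒱.Δ β := fun y hy => ⟨hy.2, hy.2⟩
    exact mem_faceIdeal_sup_of_subset hsub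
      (Ideal.Quotient.eq_zero_iff_mem.1 this)
  · intro hp
    ext α β
    rw [diag_apply, zero_apply]
    split_ifs
    · exact Ideal.Quotient.eq_zero_iff_mem.2
        (mem_faceIdeal_sup_of_subset (fun y hy => hy.1.1) hp)
    · rfl

theorem exists_algEquiv_center (h : 𝒱.Glues K 𝒱.affineSpace)
    (f : MvPolynomial I ℝ →ₐ[ℝ] 𝒱.ConvAlg K) (hf : ∀ p, f p = diag K p) :
    ∃ e : 𝒱.FaceRing K 𝒱.affineSpace ≃ₐ[ℝ] Subalgebra.center ℝ (𝒱.ConvAlg K),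
      ∀ p : MvPolynomial I ℝ, (e (Ideal.Quotient.mk _ p) : 𝒱.ConvAlg K) = f p := by
  let g : MvPolynomial I ℝ →ₐ[ℝ] Subalgebra.center ℝ (𝒱.ConvAlg K) :=
    f.codRestrict _ fun p => by
      rw [hf]
      exact diag_mem_center p
  have hg : ∀ p, (g p : 𝒱.ConvAlg K) = f p := fun p => rfl
  have hsurj : Function.Surjective g := by
    rintro ⟨z, hz⟩
    obtain ⟨p, hp⟩ := (mem_center_iff_exists_diag h z).1 hz
    exact ⟨p, Subtype.ext (by rw [hg, hf, hp])⟩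
  have hker : 𝒱.faceIdeal 𝒱.affineSpace ⊔ K = RingHom.ker g := by
    ext p
    rw [RingHom.mem_ker, ← diag_eq_zero_iff h, ← hf, ← hg, ZeroMemClass.coe_eq_zero]
  exact ⟨(Ideal.quotientEquivAlgOfEq ℝ hker).trans
    (Ideal.quotientKerAlgEquivOfSurjective hsurj), fun p => rfl⟩

end ConvAlg

theorem ζ_apply (p : MvPolynomial I ℝ) : 𝒱.ζ p = ConvAlg.diag ⊥ p := rfl

theorem quotientHom_ζ_apply (p : MvPolynomial I ℝ) :
    𝒱.quotientHom (𝒱.ζ p) = ConvAlg.diag 𝒱.linearIdeal p := by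
  ext α β
  change 𝒱.toB (ConvAlg.diag ⊥ p) α β = _
  rw [toB_apply, ConvAlg.diag_apply, ConvAlg.diag_apply]
  split_ifs
  · rfl
  · exact map_zero _

theorem glues_bot : 𝒱.Glues ⊥ 𝒱.affineSpace := by
  have := glues_affineSpace (𝒱 := 𝒱) (Nat.zero_le _)
  rwa [initialIdeal_zero] at this

theorem glues_linearIdeal : 𝒱.Glues 𝒱.linearIdeal 𝒱.affineSpace := by
  have := glues_affineSpace (𝒱 := 𝒱) le_rfl
  rwa [initialIdeal_basisForm] at this

end Center

end PolarizedArrangement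

theorem theorem4 {I : Type*} [Fintype I] (𝒱 : PolarizedArrangement I) :
    -- the image of `ζ` is the center of `B̃`
    𝒱.ζ.range = Subalgebra.center ℝ 𝒱.Btilde ∧
    -- the center of `B̃` is isomorphic to `R̃_ℋ` as a quotient of `Sym ℝ^I`
    (∃ e : 𝒱.RtildeH ≃ₐ[ℝ] Subalgebra.center ℝ 𝒱.Btilde,
      ∀ p : MvPolynomial I ℝ, (e (Ideal.Quotient.mk _ p) : 𝒱.Btilde) = 𝒱.ζ p) ∧
    -- the quotient map `B̃ → B` maps the center of `B̃` onto the center of `B`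
    (Subalgebra.center ℝ 𝒱.Btilde).map 𝒱.quotientHom = Subalgebra.center ℝ 𝒱.B ∧
    -- the center of `B` is isomorphic to `R_ℋ` as a quotient of `Sym ℝ^I`
    (∃ e : 𝒱.RH ≃ₐ[ℝ] Subalgebra.center ℝ 𝒱.B,
      ∀ p : MvPolynomial I ℝ,
        (e (Ideal.Quotient.mk _ p) : 𝒱.B) = 𝒱.quotientHom (𝒱.ζ p)) := by
  have hζ : 𝒱.ζ.range = Subalgebra.center ℝ 𝒱.Btilde := by
    ext z
    rw [PolarizedArrangement.ConvAlg.mem_center_iff_exists_diag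
      PolarizedArrangement.glues_bot]
    exact Iff.rfl
  refine ⟨hζ, PolarizedArrangement.ConvAlg.exists_algEquiv_center
    PolarizedArrangement.glues_bot 𝒱.ζ PolarizedArrangement.ζ_apply, ?_,
    PolarizedArrangement.ConvAlg.exists_algEquiv_center
      PolarizedArrangement.glues_linearIdeal (𝒱.quotientHom.comp 𝒱.ζ)
      PolarizedArrangement.quotientHom_ζ_apply⟩
  rw [← hζ]
  ext z
  rw [PolarizedArrangement.ConvAlg.mem_center_iff_exists_diag
    PolarizedArrangement.glues_linearIdeal]
  constructor
  · rintro ⟨_, ⟨p, rfl⟩, rfl⟩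
    exact ⟨p, (PolarizedArrangement.quotientHom_ζ_apply p).symm⟩
  · rintro ⟨p, rfl⟩
    exact ⟨𝒱.ζ p, ⟨p, rfl⟩, PolarizedArrangement.quotientHom_ζ_apply p⟩
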